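/- Let $M$ be a smooth manifold (Hausdorff, second countable, without boundary) of dimension $2n+1$ with $n\ge 1$. Fix a normalisation $d\eta(X,Y)=c\,\bigl(X(\eta(Y))-Y(\eta(X))-\eta([X,Y])\bigr)$ of the exterior derivative of $1$-forms, with a constant $c>0$ (the usual conventions are $c=1$ and $c=\tfrac12$). A \emph{Sasakian structure} on $M$ is a quadruple $\mathcal S=(\xi,\eta,\Phi,g)$ of a smooth vector field, a smooth $1$-form, a smooth $(1,1)$-tensor field and a Riemannian metric such that $\eta(\xi)=1$, $\Phi^2=-1+\xi\otimes\eta$, $g(\Phi X,\Phi Y)=g(X,Y)-\eta(X)\eta(Y)$, $g(\Phi X,Y)=d\eta(X,Y)$, and such that the almost complex structure $I$ on the cone $C(M)=M\times\mathbb R^+$ given by $I(Y)=\Phi(Y)+\eta(Y)\,r\partial_r$, $I(r\partial_r)=-\xi$ is integrable (its Nijenhuis tensor vanishes). Let $(\mathcal D,J)$ be an integrable, strictly pseudoconvex CR structure of codimension one on $M$, and let $\mathcal S(\mathcal D,J)$ be the set of Sasakian structures $(\xi,\eta,\Phi,g)$ with $\ker\eta=\mathcal D$ and $\Phi|_{\mathcal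 D}=J$. Assume that $(\mathcal D,J)$ is of Sasaki type, i.e. $\mathcal S(\mathcal D,J)\neq\emptyset$. Let $\mathfrak{cr}(\mathcal D,J)$ be the space of smooth vector fields $X$ with $\pounds_X\eta=a\,\eta$ for some $a\in C^\infty(M)$, where $\eta$ is a $1$-form with kernel $\mathcal D$, and $\pounds_XJ=0$, with the $C^\infty$ compact-open topology; let $\mathfrak{CR}(\mathcal D,J)$ be the group of diffeomorphisms $\varphi$ of $M$ with $\varphi^*\eta=f\eta$ for some nowhere vanishing $f\in C^\infty(M)$ and $\varphi_*J=J\varphi_*$. Let $\mathfrak{cr}^+(\mathcal D,J)$ be the set of all $X\in\mathfrak{cr}(\mathcal D,J)$ such that $\eta(X)>0$ on $M$ for every $(\xi,\eta,\Phi,g)\in\mathcal S(\mathcal D,J)$. Then: (a) The map $(\xi,\eta,\Phi,g)\mapsto\xi$ is a bijection from $\mathcal S(\mathcal D,J)$ onto $\mathfrak{cr}^+(\mathcal D,J)$; for any $(\xi_0,\eta_0,\Phi_0,g_0)\in\mathcal S(\mathcal D,J)$, the structure corresponding to $\xi\in\mathfrak{cr}^+(\mathcal D,J)$ has contact form $\eta=\eta_0/\eta_0(\xi)$.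 (b) $\mathfrak{cr}^+(\mathcal D,J)$ is a convex cone in $\mathfrak{cr}(\mathcal D,J)$ (convex, and closed under multiplication by positive reals), and it is open in $\mathfrak{cr}(\mathcal D,J)$ if $M$ is compact. (c) $\mathfrak{cr}^+(\mathcal D,J)$ is invariant under the adjoint action $X\mapsto\varphi_*X$ of $\mathfrak{CR}(\mathcal D,J)$: $\varphi_*\bigl(\mathfrak{cr}^+(\mathcal D,J)\bigr)=\mathfrak{cr}^+(\mathcal D,J)$ for every $\varphi\in\mathfrak{CR}(\mathcal D,J)$. -/

import Mathlib

open scoped Manifold ContDiff UniformConvergence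

noncomputable section

namespace SasakiCR

section General

variable {E : Type*} [NormedAddCommGroup E] [NormedSpace ℝ E]
  {M : Type*} [TopologicalSpace M] [ChartedSpace E M] [IsManifold 𝓘(ℝ, E) ∞ M]

/-- The space `𝔛(M)` of smooth vector fields on `M`. -/
abbrev SmoothVF (E : Type*) [NormedAddCommGroup E] [NormedSpace ℝ E]
    (M : Type*) [TopologicalSpace M] [ChartedSpace E M] [IsManifold 𝓘(ℝ, E) ∞ M] : Type _ :=
  ContMDiffSection (M := M) 𝓘(ℝ, E) E ∞ (fun p : M => TangentSpace 𝓘(ℝ, E) p)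

/-- The vector field `X` read in the preferred chart at `x₀`, as a map from the model space to
itself (meaningful on the target of the chart). -/
def SmoothVF.localRep (X : SmoothVF E M) (x₀ : M) : E → E := fun y =>
  (trivializationAt E (fun p : M => TangentSpace 𝓘(ℝ, E) p) x₀
    ⟨(extChartAt 𝓘(ℝ, E) x₀).symm y, X ((extChartAt 𝓘(ℝ, E) x₀).symm y)⟩).2

/-- The `C^∞` compact-open topology on `𝔛(M)`: uniform convergence, on every compact subset of
every chart domain, of the local expressions together with all their derivatives. -/
instance SmoothVF.topology : TopologicalSpace (SmoothVF E M) :=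
  ⨅ (x₀ : M) (k : ℕ), TopologicalSpace.induced
    (fun X : SmoothVF E M =>
      UniformOnFun.ofFun {K : Set E | IsCompact K ∧ K ⊆ (extChartAt 𝓘(ℝ, E) x₀).target}
        (iteratedFDeriv ℝ k (X.localRep x₀)))
    inferInstance

/-- The Lie bracket `[X, Y]` at `p`. -/
abbrev bracket (X Y : ∀ p : M, TangentSpace 𝓘(ℝ, E) p) (p : M) : TangentSpace 𝓘(ℝ, E) p :=
  VectorField.mlieBracket 𝓘(ℝ, E) X Y p

/-- A smooth real function on `M`. -/
abbrev IsSmoothFun (E : Type*) [NormedAddCommGroup E] [NormedSpace ℝ E]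
    {M : Type*} [TopologicalSpace M] [ChartedSpace E M] (f : M → ℝ) : Prop :=
  ContMDiff 𝓘(ℝ, E) 𝓘(ℝ, ℝ) ∞ f

/-- A smooth `1`-form: a field of linear forms whose value on every smooth vector field is a
smooth function. -/
structure OneForm (E : Type*) [NormedAddCommGroup E] [NormedSpace ℝ E]
    (M : Type*) [TopologicalSpace M] [ChartedSpace E M] [IsManifold 𝓘(ℝ, E) ∞ M] where
  toFun : ∀ p : M, TangentSpace 𝓘(ℝ, E) p →ₗ[ℝ] ℝ
  smooth : ∀ X : SmoothVF E M, IsSmoothFun E (fun p => toFun p (X p))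

instance : CoeFun (OneForm E M) (fun _ => ∀ p : M, TangentSpace 𝓘(ℝ, E) p →ₗ[ℝ] ℝ) :=
  ⟨OneForm.toFun⟩

/-- The exterior derivative `dη(X, Y) = c (X(η(Y)) - Y(η(X)) - η([X, Y]))`. The constant `c` is
the normalisation of `d` on `1`-forms; the two conventions in use are `c = 1` and `c = 1/2`. -/
def OneForm.d (c : ℝ) (η : OneForm E M) (X Y : SmoothVF E M) (p : M) : ℝ :=
  c * (mvfderiv 𝓘(ℝ, E) (fun q => η q (Y q)) p (X p)
    - mvfderiv 𝓘(ℝ, E) (fun q => η q (X q)) p (Y p)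
    - η p (bracket X Y p))

/-- The Lie derivative of a `1`-form, `(£_X η)(Y) = X(η(Y)) - η([X, Y])`. -/
def OneForm.lieDeriv (X : SmoothVF E M) (η : OneForm E M) (Y : SmoothVF E M) (p : M) : ℝ :=
  mvfderiv 𝓘(ℝ, E) (fun q => η q (Y q)) p (X p) - η p (bracket X Y p)

/-- A smooth tensor field of type `(1,1)`: a field of endomorphisms taking smooth vector fields to
smooth vector fields. -/
structure EndoField (E : Type*) [NormedAddCommGroup E] [NormedSpace ℝ E]
    (M : Type*) [TopologicalSpace M] [ChartedSpace E M] [IsManifold 𝓘(ℝ, E) ∞ M] where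
  toFun : ∀ p : M, TangentSpace 𝓘(ℝ, E) p →ₗ[ℝ] TangentSpace 𝓘(ℝ, E) p
  smooth : ∀ X : SmoothVF E M, ContMDiff 𝓘(ℝ, E) 𝓘(ℝ, E).tangent ∞
    (fun p => (⟨p, toFun p (X p)⟩ : TangentBundle 𝓘(ℝ, E) M))

instance : CoeFun (EndoField E M)
    (fun _ => ∀ p : M, TangentSpace 𝓘(ℝ, E) p →ₗ[ℝ] TangentSpace 𝓘(ℝ, E) p) :=
  ⟨EndoField.toFun⟩

/-- A smooth Riemannian metric on `M`. -/
structure Metric (E : Type*) [NormedAddCommGroup E] [NormedSpace ℝ E]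
    (M : Type*) [TopologicalSpace M] [ChartedSpace E M] [IsManifold 𝓘(ℝ, E) ∞ M] where
  toFun : ∀ p : M, TangentSpace 𝓘(ℝ, E) p →ₗ[ℝ] TangentSpace 𝓘(ℝ, E) p →ₗ[ℝ] ℝ
  symm : ∀ (p : M) (u v : TangentSpace 𝓘(ℝ, E) p), toFun p u v = toFun p v u
  pos : ∀ (p : M) (v : TangentSpace 𝓘(ℝ, E) p), v ≠ 0 → 0 < toFun p v v
  smooth : ∀ X Y : SmoothVF E M, IsSmoothFun E (fun p => toFun p (X p) (Y p))

instance : CoeFun (Metric E M)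
    (fun _ => ∀ p : M, TangentSpace 𝓘(ℝ, E) p →ₗ[ℝ] TangentSpace 𝓘(ℝ, E) p →ₗ[ℝ] ℝ) :=
  ⟨Metric.toFun⟩

/-! ### The cone and normality -/

/-- The cone `C(M) = M × ℝ⁺`, as an open subset of `M × ℝ`. -/
def cone (M : Type*) : Set (M × ℝ) := {q | 0 < q.2}

/-- Vector fields on `M × ℝ`. The tangent space at `(p, r)` is `T_p M × ℝ`, where `(v, a)` stands
for `v + a ∂_r`. -/
abbrev ConeVF (E : Type*) [NormedAddCommGroup E] [NormedSpace ℝ E]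
    (M : Type*) [TopologicalSpace M] [ChartedSpace E M] : Type _ :=
  ∀ q : M × ℝ, TangentSpace (𝓘(ℝ, E).prod 𝓘(ℝ, ℝ)) q

/-- Smoothness on the cone. -/
def ConeVF.IsSmooth (X : ConeVF E M) : Prop :=
  ContMDiffOn (𝓘(ℝ, E).prod 𝓘(ℝ, ℝ)) (𝓘(ℝ, E).prod 𝓘(ℝ, ℝ)).tangent ∞
    (fun q => (⟨q, X q⟩ : TangentBundle (𝓘(ℝ, E).prod 𝓘(ℝ, ℝ)) (M × ℝ))) (cone M)

/-- The component in `T_p M` of a tangent vector of `M × ℝ` at `(p, r)`. -/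
def horPart (q : M × ℝ) (w : TangentSpace (𝓘(ℝ, E).prod 𝓘(ℝ, ℝ)) q) : TangentSpace 𝓘(ℝ, E) q.1 :=
  (w : E × ℝ).1

/-- The coefficient of `∂_r` in a tangent vector of `M × ℝ` at `(p, r)`. -/
def radPart (q : M × ℝ) (w : TangentSpace (𝓘(ℝ, E).prod 𝓘(ℝ, ℝ)) q) : ℝ :=
  (w : E × ℝ).2

/-- The tangent vector `v + a ∂_r` of `M × ℝ` at `(p, r)`. -/
def coneVec (q : M × ℝ) (v : TangentSpace 𝓘(ℝ, E) q.1) (a : ℝ) :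
    TangentSpace (𝓘(ℝ, E).prod 𝓘(ℝ, ℝ)) q :=
  ((v, a) : E × ℝ)

/-- The almost complex structure on the cone determined by
`I(Y) = Φ(Y) + η(Y) r∂_r` and `I(r∂_r) = -ξ`; hence `I(∂_r) = -ξ / r`. -/
def coneI (ξ : SmoothVF E M) (η : OneForm E M) (Φ : EndoField E M) (X : ConeVF E M) :
    ConeVF E M := fun q =>
  coneVec q (Φ q.1 (horPart q (X q)) - (radPart q (X q) / q.2) • ξ q.1)
    (η q.1 (horPart q (X q)) * q.2)

/-- `(ξ, η, Φ)` is normal: the almost complex structure on the cone is integrable, that is, its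
Nijenhuis tensor `[IX, IY] - I[IX, Y] - I[X, IY] - [X, Y]` vanishes on the cone. -/
def IsNormal (ξ : SmoothVF E M) (η : OneForm E M) (Φ : EndoField E M) : Prop :=
  let br : ConeVF E M → ConeVF E M → ConeVF E M :=
    VectorField.mlieBracket (𝓘(ℝ, E).prod 𝓘(ℝ, ℝ))
  let I : ConeVF E M → ConeVF E M := coneI ξ η Φ
  ∀ X Y : ConeVF E M, X.IsSmooth → Y.IsSmooth → ∀ q ∈ cone M,
    br (I X) (I Y) q - I (br (I X) Y) q - I (br X (I Y)) q - br X Y q = 0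

/-! ### Sasakian structures -/

/-- A Sasakian structure `(ξ, η, Φ, g)` on `M`: a normal contact metric structure
(with `d` on `1`-forms normalised by `c`). -/
structure SasakianStructure (c : ℝ) (E : Type*) [NormedAddCommGroup E] [NormedSpace ℝ E]
    (M : Type*) [TopologicalSpace M] [ChartedSpace E M] [IsManifold 𝓘(ℝ, E) ∞ M] where
  ξ : SmoothVF E M
  η : OneForm E M
  Φ : EndoField E M
  g : Metric E M
  eta_xi : ∀ p, η p (ξ p) = 1
  phi_sq : ∀ p v, Φ p (Φ p v) = -v + η p v • ξ p
  compatible : ∀ p u v, g p (Φ p u) (Φ p v) = g p u v - η p u * η p v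
  contact_metric : ∀ (X Y : SmoothVF E M) (p : M), g p (Φ p (X p)) (Y p) = η.d c X Y p
  normal : IsNormal ξ η Φ

/-! ### CR structures -/

/-- An (integrable, codimension one) CR structure `(𝒟, J)` on `M`: a smooth corank-one subbundle
`𝒟` of `TM` with a smooth complex structure `J` on its fibres whose Nijenhuis tensor vanishes. -/
structure CRStructure (E : Type*) [NormedAddCommGroup E] [NormedSpace ℝ E]
    (M : Type*) [TopologicalSpace M] [ChartedSpace E M] [IsManifold 𝓘(ℝ, E) ∞ M] where
  D : ∀ p : M, Submodule ℝ (TangentSpace 𝓘(ℝ, E) p)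
  J : ∀ p : M, D p →ₗ[ℝ] D p
  corank_one : ∀ p : M, Module.finrank ℝ (D p) + 1 = Module.finrank ℝ E
  /-- `𝒟` is spanned by its smooth sections -/
  smooth_D : ∀ (p : M) (v : D p), ∃ X : SmoothVF E M, (∀ q, X q ∈ D q) ∧ X p = v
  /-- `J` takes smooth sections of `𝒟` to smooth sections -/
  smooth_J : ∀ (X : SmoothVF E M) (hX : ∀ q, X q ∈ D q),
    ContMDiff 𝓘(ℝ, E) 𝓘(ℝ, E).tangent ∞
      (fun p => (⟨p, (J p ⟨X p, hX p⟩ : D p)⟩ : TangentBundle 𝓘(ℝ, E) M))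
  J_sq : ∀ (p : M) (v : D p), J p (J p v) = -v
  /-- `[JX, Y] + [X, JY]` is a section of `𝒟` and `J([JX, Y] + [X, JY]) = [JX, JY] - [X, Y]` -/
  integrable : ∀ (X Y : SmoothVF E M) (hX : ∀ q, X q ∈ D q) (hY : ∀ q, Y q ∈ D q) (p : M),
    ∃ h : bracket (fun q => (J q ⟨X q, hX q⟩ : D q)) Y p
        + bracket X (fun q => (J q ⟨Y q, hY q⟩ : D q)) p ∈ D p,
      ((J p ⟨_, h⟩ : D p) : TangentSpace 𝓘(ℝ, E) p) =
        bracket (fun q => (J q ⟨X q, hX q⟩ : D q)) (fun q => (J q ⟨Y q, hY q⟩ : D q)) p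
          - bracket X Y p

namespace CRStructure

variable (C : CRStructure E M)

/-- `X` is a section of `𝒟`. -/
def IsSection (X : SmoothVF E M) : Prop := ∀ p, X p ∈ C.D p

/-- The section `JX` of `𝒟`, for a section `X` of `𝒟`. -/
def applyJ (X : SmoothVF E M) (hX : C.IsSection X) : SmoothVF E M :=
  ⟨fun p => (C.J p ⟨X p, hX p⟩ : C.D p), C.smooth_J X hX⟩

/-- The `1`-form `η` represents `𝒟`: `ker η = 𝒟`. -/
def Represents (η : OneForm E M) : Prop := ∀ p, LinearMap.ker (η p) = C.D p

/-- Strict pseudoconvexity: for some `1`-form `η` representing `𝒟`, the Levi form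
`dη(X, JX)` is positive definite on `𝒟`. -/
def IsStrictlyPseudoconvex : Prop :=
  ∃ η : OneForm E M, C.Represents η ∧
    ∀ (X : SmoothVF E M) (hX : C.IsSection X) (p : M), X p ≠ 0 → 0 < η.d 1 X (C.applyJ X hX) p

/-- The set `𝒮(𝒟, J)` of Sasakian structures with underlying CR structure `(𝒟, J)`. -/
def sasakianStructures (c : ℝ) : Set (SasakianStructure c E M) :=
  {S | C.Represents S.η ∧ ∀ (p : M) (v : C.D p), S.Φ p v = C.J p v}

/-- `(𝒟, J)` is of Sasaki type. -/
def IsSasakiType (c : ℝ) : Prop := (C.sasakianStructures c).Nonempty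

/-- `X ∈ 𝔠𝔬𝔫(𝒟)`: `£_X η = a η` for a smooth function `a`. The condition is the same for all `η`
representing `𝒟`. -/
def IsContactField (X : SmoothVF E M) : Prop :=
  ∀ η : OneForm E M, C.Represents η → ∃ a : M → ℝ, IsSmoothFun E a ∧
    ∀ (Y : SmoothVF E M) (p : M), OneForm.lieDeriv X η Y p = a p * η p (Y p)

/-- `£_X J = 0`: the bracket with `X` preserves sections of `𝒟` and commutes with `J` there. -/
def PreservesJ (X : SmoothVF E M) : Prop :=
  ∀ (Y : SmoothVF E M) (hY : C.IsSection Y) (p : M), ∃ h : bracket X Y p ∈ C.D p,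
    bracket X (C.applyJ Y hY) p = (C.J p ⟨bracket X Y p, h⟩ : C.D p)

/-- The condition defining `𝔠𝔯(𝒟, J)`. -/
def IsCRField (X : SmoothVF E M) : Prop := C.IsContactField X ∧ C.PreservesJ X

theorem bracket_add_left [CompleteSpace E] (X Y Z : SmoothVF E M) (p : M) :
    bracket (X + Y : SmoothVF E M) Z p = bracket X Z p + bracket Y Z p :=
  VectorField.mlieBracket_add_left (X.contMDiff.mdifferentiableAt (by simp))
    (Y.contMDiff.mdifferentiableAt (by simp))

theorem bracket_smul_left [CompleteSpace E] (t : ℝ) (X Z : SmoothVF E M) (p : M) :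
    bracket (t • X : SmoothVF E M) Z p = t • bracket X Z p :=
  VectorField.mlieBracket_const_smul_left (X.contMDiff.mdifferentiableAt (by simp))

theorem IsCRField.add [CompleteSpace E] {X Y : SmoothVF E M} (hX : C.IsCRField X)
    (hY : C.IsCRField Y) : C.IsCRField (X + Y) := by
  refine ⟨fun η hη => ?_, fun Z hZ p => ?_⟩
  · obtain ⟨a, ha, ha'⟩ := hX.1 η hη
    obtain ⟨b, hb, hb'⟩ := hY.1 η hη
    refine ⟨fun p => a p + b p, ha.add hb, fun Z p => ?_⟩
    have h1 := ha' Z p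
    have h2 := hb' Z p
    simp only [OneForm.lieDeriv] at h1 h2 ⊢
    rw [bracket_add_left, ContMDiffSection.coe_add, Pi.add_apply, map_add, map_add]
    linarith
  · obtain ⟨h1, h1'⟩ := hX.2 Z hZ p
    obtain ⟨h2, h2'⟩ := hY.2 Z hZ p
    refine ⟨by rw [bracket_add_left]; exact (C.D p).add_mem h1 h2, ?_⟩
    rw [bracket_add_left, h1', h2', ← Submodule.coe_add, ← map_add]
    congr 2
    exact Subtype.ext (bracket_add_left X Y Z p).symm

theorem IsCRField.smul [CompleteSpace E] (t : ℝ) {X : SmoothVF E M} (hX : C.IsCRField X) :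
    C.IsCRField (t • X) := by
  refine ⟨fun η hη => ?_, fun Z hZ p => ?_⟩
  · obtain ⟨a, ha, ha'⟩ := hX.1 η hη
    refine ⟨fun p => t * a p, contMDiff_const.mul ha, fun Z p => ?_⟩
    have h1 := ha' Z p
    simp only [OneForm.lieDeriv] at h1 ⊢
    rw [bracket_smul_left, ContMDiffSection.coe_smul, Pi.smul_apply, map_smul, map_smul,
      smul_eq_mul, smul_eq_mul, ← mul_sub, h1, mul_assoc]
  · obtain ⟨h1, h1'⟩ := hX.2 Z hZ p
    refine ⟨by rw [bracket_smul_left]; exact (C.D p).smul_mem t h1, ?_⟩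
    rw [bracket_smul_left, h1', ← Submodule.coe_smul, ← map_smul]
    congr 2
    exact Subtype.ext (bracket_smul_left t X Z p).symm

/-- The space `𝔠𝔯(𝒟, J) = {X ∈ 𝔠𝔬𝔫(𝒟) | £_X J = 0}` of infinitesimal CR transformations; it
carries the subspace topology of `𝔛(M)`. -/
def cr [CompleteSpace E] : Submodule ℝ (SmoothVF E M) where
  carrier := {X | C.IsCRField X}
  add_mem' hX hY := IsCRField.add C hX hY
  zero_mem' := by
    have h : ∀ Z : SmoothVF E M, ∀ p, bracket (0 : SmoothVF E M) Z p = 0 := fun Z p => by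
      have := bracket_smul_left 0 (0 : SmoothVF E M) Z p
      rwa [zero_smul, zero_smul] at this
    refine ⟨fun η hη => ⟨fun _ => 0, contMDiff_const, fun Z p => ?_⟩, fun Z hZ p => ?_⟩
    · simp only [OneForm.lieDeriv]
      rw [h, ContMDiffSection.coe_zero, Pi.zero_apply, map_zero, map_zero]
      simp
    · refine ⟨by rw [h]; exact (C.D p).zero_mem, ?_⟩
      rw [h]
      have h0 : (⟨bracket (0 : SmoothVF E M) Z p, by rw [h]; exact (C.D p).zero_mem⟩ : C.D p) = 0 :=
        Subtype.ext (h Z p)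
      rw [h0, map_zero, Submodule.coe_zero]
  smul_mem' t _ hX := IsCRField.smul C t hX

/-- The set `𝔠𝔯⁺(𝒟, J)` of positive elements of `𝔠𝔯(𝒟, J)`: those `X` with `η(X) > 0` for every
`(ξ, η, Φ, g) ∈ 𝒮(𝒟, J)`. -/
def crPos [CompleteSpace E] (c : ℝ) : Set (SmoothVF E M) :=
  {X | X ∈ C.cr ∧ ∀ S ∈ C.sasakianStructures c, ∀ p, 0 < S.η p (X p)}

/-- The group `ℭℜ(𝒟, J)` of CR automorphisms: diffeomorphisms `φ` with `φ^*η = f η` for a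
nowhere vanishing smooth function `f` (for the forms `η` representing `𝒟`) and `φ_* J = J φ_*`. -/
def CRAut : Set (M ≃ₘ^∞⟮𝓘(ℝ, E), 𝓘(ℝ, E)⟯ M) :=
  {φ | (∀ η : OneForm E M, C.Represents η → ∃ f : M → ℝ, IsSmoothFun E f ∧ (∀ p, f p ≠ 0) ∧
        ∀ (p : M) (v : TangentSpace 𝓘(ℝ, E) p),
          η (φ p) (mfderiv 𝓘(ℝ, E) 𝓘(ℝ, E) φ p v) = f p * η p v) ∧
      ∀ (p : M) (v : C.D p), ∃ h : mfderiv 𝓘(ℝ, E) 𝓘(ℝ, E) φ p v ∈ C.D (φ p),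
        mfderiv 𝓘(ℝ, E) 𝓘(ℝ, E) φ p (C.J p v) = (C.J (φ p) ⟨_, h⟩ : C.D (φ p))}

end CRStructure

/-- The push-forward `φ_* X`, `(φ_* X)(q) = dφ (X(φ⁻¹ q))`, which is the adjoint action of a
diffeomorphism on vector fields. -/
def pushforward (φ : M ≃ₘ^∞⟮𝓘(ℝ, E), 𝓘(ℝ, E)⟯ M) (X : SmoothVF E M) : SmoothVF E M where
  toFun q := (mfderiv 𝓘(ℝ, E) 𝓘(ℝ, E) φ (φ.symm q) (X (φ.symm q)) : E)
  contMDiff_toFun := by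
    have h := ((φ.contMDiff.contMDiff_tangentMap (m := ∞) (by simp)).comp X.contMDiff).comp
      φ.symm.contMDiff
    convert h using 1
    funext q
    simp only [Function.comp_apply, tangentMap]
    have : φ (φ.symm q) = q := φ.apply_symm_apply q
    congr 1
    · exact this.symm

end General

end SasakiCR

end

noncomputable section

open scoped Topology

set_option linter.unusedSectionVars false

/-! Fix one structure `S = (ξ₀, η₀, Φ₀, g₀)` in `𝒮(𝒟, J)`. Any other form with kernel `𝒟` is a
multiple of `η₀`. For a Sasakian form `η` and a section `Y` of `𝒟`, nonzero at the point, the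
contact metric condition gives `c η([Y, JY]) = -g(Y, Y) < 0`, so the factor relating two Sasakian
forms is positive (`eta_reeb_pos`; this needs `𝒟 ≠ 0`). Hence positivity can be tested on the single
form `η₀`, and since a field preserving `J` is automatically a contact field, `crPos` consists of
the fields that preserve `J` and satisfy `η₀(X) > 0` (`mem_crPos_iff`).

For (a), a Reeb field preserves `J`: the vanishing of the Nijenhuis tensor on `Y` and `r∂_r` says
`[ξ, ΦY] = Φ[ξ, Y]` (`preservesJ_of_isNormal`). Conversely, a positive CR field `ξ` determines `η =
η₀/η₀(ξ)`, `Φ = Φ₀ ∘ pr` with `pr` the projection to `𝒟` along `ξ`, and `g = g₀(pr, pr)/η₀(ξ) + η ⊗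
η` (`deform`). Here `dη(ξ, ·) = 0`, while on `𝒟` the form `dη` is `dη₀/η₀(ξ)`, whence the contact
metric condition. Normality follows by evaluating the tensorial Nijenhuis expression on fields `A +
bξ + β r∂_r`, with `A` a section of `𝒟` and `b`, `β` constant: it reduces to CR integrability and
`£_ξ J = 0` (`isNormal_of_preservesJ`). Injectivity holds because `ξ` and `(𝒟, J)` determine `η` and
`Φ`, and then `dη` determines `g` (`eq_of_reeb_eq`).

For (b), convexity is linearity of each `η`, and openness is a uniform `C⁰` estimate for `η₀(X)` on
a compact manifold. For (c), a CR automorphism transports brackets, and the sign of the Levi form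
forces its conformal factor to be positive. -/

namespace SasakiCR

variable {E : Type*} [NormedAddCommGroup E] [NormedSpace ℝ E]
  {M : Type*} [TopologicalSpace M] [ChartedSpace E M] [IsManifold 𝓘(ℝ, E) ∞ M]

/-! ### Smooth vector fields: products, brackets, local extension -/

section VectorFields

namespace SmoothVF

/-- The product `f X` of a smooth function and a smooth vector field. -/
def fsmul (f : M → ℝ) (hf : IsSmoothFun E f) (X : SmoothVF E M) : SmoothVF E M where
  toFun p := f p • X p
  contMDiff_toFun := ContMDiff.smul_section hf X.contMDiff

theorem mdifferentiableAt (X : SmoothVF E M) (p : M) :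
    MDifferentiableAt 𝓘(ℝ, E) 𝓘(ℝ, E).tangent
      (fun q => (⟨q, X q⟩ : TangentBundle 𝓘(ℝ, E) M)) p :=
  X.contMDiff.mdifferentiableAt (by simp)

/-- The Lie bracket of two smooth vector fields, as a smooth vector field. -/
def lie [CompleteSpace E] (X Y : SmoothVF E M) : SmoothVF E M where
  toFun := bracket X Y
  contMDiff_toFun := by
    have : IsManifold 𝓘(ℝ, E) (((⊤ : ℕ∞) : WithTop ℕ∞) + 1) M := by simpa
    have : IsManifold 𝓘(ℝ, E) (minSmoothness ℝ 2) M :=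
      IsManifold.of_le (n := ∞) (by
        rw [minSmoothness_of_isRCLikeNormedField]
        exact WithTop.coe_le_coe.2 (le_top : (2 : ℕ∞) ≤ ⊤))
    exact ContDiff.mlieBracket_vectorField (m := ⊤) (n := ⊤) X.contMDiff Y.contMDiff (by simp)

/-- A vector field that is smooth on an open set agrees with a globally defined smooth vector field
near each point of that set. -/
theorem exists_eventuallyEq [FiniteDimensional ℝ E] [T2Space M]
    {s : ∀ p : M, TangentSpace 𝓘(ℝ, E) p} {u : Set M} (hu : IsOpen u)
    (hs : ContMDiffOn 𝓘(ℝ, E) 𝓘(ℝ, E).tangent ∞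
      (fun q => (⟨q, s q⟩ : TangentBundle 𝓘(ℝ, E) M)) u) {p : M} (hp : p ∈ u) :
    ∃ X : SmoothVF E M, ∀ᶠ q in 𝓝 p, X q = s q := by
  obtain ⟨f, -, hf⟩ := (SmoothBumpFunction.nhds_basis_tsupport (I := 𝓘(ℝ, E)) p).mem_iff.1
    (hu.mem_nhds hp)
  refine ⟨⟨fun q => f q • s q,
    ContMDiffOn.smul_section_of_tsupport f.contMDiff.contMDiffOn hu hf hs⟩, ?_⟩
  filter_upwards [f.eventuallyEq_one] with q hq
  change f q • s q = s q
  rw [hq, Pi.one_apply, one_smul]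

end SmoothVF

/-- The value of a smooth vector field on a smooth function is a smooth function. -/
theorem isSmoothFun_mvfderiv {f : M → ℝ} (hf : IsSmoothFun E f) (X : SmoothVF E M) :
    IsSmoothFun E (fun p => mvfderiv 𝓘(ℝ, E) f p (X p)) := by
  have h := (hf.contMDiff_tangentMap (m := ∞) (by simp)).comp X.contMDiff
  exact (contMDiff_snd_tangentBundle_modelSpace ℝ 𝓘(ℝ, ℝ)).comp h

end VectorFields

/-! ### Lie brackets of fields `X + β r∂_r` on `M × ℝ` -/

section ProductBracket

/-- Pullbacks of vector fields are defined through `ContinuousLinearMap.inverse`; once invertibility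
is known, a one-sided inverse identifies it. -/
theorem inverse_apply_of_comp_eq_id {G F : Type*} [AddCommGroup G] [Module ℝ G]
    [TopologicalSpace G] [AddCommGroup F] [Module ℝ F] [TopologicalSpace F]
    {A : G →L[ℝ] F} {B : F →L[ℝ] G} (hA : A.IsInvertible)
    (h : A.comp B = ContinuousLinearMap.id ℝ F) (u : F) : A.inverse u = B u := by
  obtain ⟨e, rfl⟩ := hA
  rw [ContinuousLinearMap.inverse_equiv]
  have := congrArg (fun T : F →L[ℝ] F => T u) h
  exact e.symm_apply_eq.2 this.symm

section ChartRep

variable {H F N : Type*} [NormedAddCommGroup F] [NormedSpace ℝ F]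
  [TopologicalSpace H] (I : ModelWithCorners ℝ F H) [TopologicalSpace N] [ChartedSpace H N]

/-- A vector field read in the preferred chart at `q`. -/
def chartRep (V : ∀ q : N, TangentSpace I q) (q : N) : F → F := fun y =>
  mfderiv I 𝓘(ℝ, F) (extChartAt I q) ((extChartAt I q).symm y) (V ((extChartAt I q).symm y))

variable {I} [I.Boundaryless] [IsManifold I 1 N]

theorem mpullbackWithin_eventuallyEq_chartRep (V : ∀ q : N, TangentSpace I q) (q : N) :
    VectorField.mpullbackWithin 𝓘(ℝ, F) I (extChartAt I q).symm V (Set.range I)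
      =ᶠ[𝓝 (extChartAt I q q)] chartRep I V q := by
  filter_upwards [extChartAt_target_mem_nhds (I := I) q] with y hy
  exact inverse_apply_of_comp_eq_id (isInvertible_mfderivWithin_extChartAt_symm hy)
    (mfderivWithin_extChartAt_symm_comp_mfderiv_extChartAt hy) _

-- Without boundary, the manifold bracket is an ordinary bracket of chart expressions, so brackets
-- on `M × ℝ` and on `M` can be compared in the model space.
open VectorField in
theorem mlieBracket_eq_lieBracket_chartRep (V W : ∀ q : N, TangentSpace I q) (q : N) :
    mlieBracket I V W q = lieBracket ℝ (chartRep I V q) (chartRep I W q) (extChartAt I q q) := by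
  have hu : (extChartAt I q).symm ⁻¹' Set.univ ∩ Set.range I = Set.univ := by
    simp [I.range_eq_univ]
  obtain ⟨V', hV'⟩ : ∃ V' : F → F,
      V' = mpullbackWithin 𝓘(ℝ, F) I (extChartAt I q).symm V (Set.range I) := ⟨_, rfl⟩
  obtain ⟨W', hW'⟩ : ∃ W' : F → F,
      W' = mpullbackWithin 𝓘(ℝ, F) I (extChartAt I q).symm W (Set.range I) := ⟨_, rfl⟩
  have h : mlieBracket I V W q = lieBracketWithin ℝ V' W'
      ((extChartAt I q).symm ⁻¹' Set.univ ∩ Set.range I) (extChartAt I q q) := by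
    subst hV' hW'
    -- The derivative of the preferred chart at its own base point is the identity, so the outer
    -- pullback does nothing.
    exact inverse_apply_of_comp_eq_id
      (isInvertible_mfderiv_extChartAt (mem_extChartAt_source (I := I) q))
      (B := ContinuousLinearMap.id ℝ F)
      ((congrArg (fun A : F →L[ℝ] F => A.comp (ContinuousLinearMap.id ℝ F))
        (mfderiv_extChartAt_self (I := I) (x := q))).trans (by ext; rfl)) _
  have hV : V' =ᶠ[𝓝 (extChartAt I q q)] chartRep I V q :=
    hV' ▸ mpullbackWithin_eventuallyEq_chartRep V q
  have hW : W' =ᶠ[𝓝 (extChartAt I q q)] chartRep I W q :=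
    hW' ▸ mpullbackWithin_eventuallyEq_chartRep W q
  rw [h, hu, lieBracketWithin_univ, hV.lieBracket_vectorField_eq hW]

theorem differentiableAt_chartRep [IsManifold I 2 N] [CompleteSpace F]
    {V : ∀ q : N, TangentSpace I q} {q : N}
    (hV : MDifferentiableAt I I.tangent (fun q => (⟨q, V q⟩ : TangentBundle I N)) q) :
    DifferentiableAt ℝ (chartRep I V q) (extChartAt I q q) := by
  have h := MDifferentiableWithinAt.differentiableWithinAt_mpullbackWithin_vectorField
    (mdifferentiableWithinAt_univ.2 hV)
  refine DifferentiableAt.congr_of_eventuallyEq (DifferentiableWithinAt.differentiableAt h ?_)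
    (mpullbackWithin_eventuallyEq_chartRep V q).symm
  simp [I.range_eq_univ]

end ChartRep

/-- The vector field `X + β r ∂_r` on `M × ℝ`, with `X` a vector field on `M`. -/
def prodField (X : ∀ p : M, TangentSpace 𝓘(ℝ, E) p) (β : ℝ) : ConeVF E M :=
  fun q => coneVec q (X q.1) (β * q.2)

theorem chartRep_prodField (X : ∀ p : M, TangentSpace 𝓘(ℝ, E) p) (β : ℝ) (q : M × ℝ) :
    chartRep (𝓘(ℝ, E).prod 𝓘(ℝ, ℝ)) (prodField X β) q
    =ᶠ[𝓝 (extChartAt (𝓘(ℝ, E).prod 𝓘(ℝ, ℝ)) q q)]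
    fun y => (chartRep 𝓘(ℝ, E) X q.1 y.1, β * y.2) := by
  filter_upwards [extChartAt_target_mem_nhds (I := 𝓘(ℝ, E).prod 𝓘(ℝ, ℝ)) q] with y hy
  rw [extChartAt_prod, PartialEquiv.prod_target] at hy
  have h0 : (extChartAt (𝓘(ℝ, E).prod 𝓘(ℝ, ℝ)) q : M × ℝ → E × ℝ) =
      Prod.map (extChartAt 𝓘(ℝ, E) q.1) (id : ℝ → ℝ) := by
    rw [extChartAt_prod]; rfl
  have hs : (extChartAt (𝓘(ℝ, E).prod 𝓘(ℝ, ℝ)) q).symm y =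
      ((extChartAt 𝓘(ℝ, E) q.1).symm y.1, y.2) := by
    rw [extChartAt_prod]; rfl
  unfold chartRep
  rw [hs, h0, modelWithCornersSelf_prod, ← chartedSpaceSelf_prod]
  have := mfderiv_prodMap (I := 𝓘(ℝ, E)) (I' := 𝓘(ℝ, ℝ)) (J := 𝓘(ℝ, E)) (J' := 𝓘(ℝ, ℝ))
    (p := ((extChartAt 𝓘(ℝ, E) q.1).symm y.1, y.2))
    (f := extChartAt 𝓘(ℝ, E) q.1) (g := (id : ℝ → ℝ))
    (mdifferentiableAt_extChartAt (by
      simpa using (extChartAt 𝓘(ℝ, E) q.1).map_target hy.1)) mdifferentiableAt_id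
  rw [mfderiv_id] at this
  exact congrArg (fun A : E × ℝ →L[ℝ] E × ℝ =>
    A (X ((extChartAt 𝓘(ℝ, E) q.1).symm y.1), β * y.2)) this

/-- The derivative is block diagonal, and the linear radial parts `β r` and `γ r` commute. -/
theorem lieBracket_prod_linear {V W : E → E} {x : E × ℝ} (hV : DifferentiableAt ℝ V x.1)
    (hW : DifferentiableAt ℝ W x.1) (β γ : ℝ) :
    VectorField.lieBracket ℝ (fun y : E × ℝ => (V y.1, β * y.2)) (fun y => (W y.1, γ * y.2)) x =
      (VectorField.lieBracket ℝ V W x.1, 0) := by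
  have key : ∀ {U : E → E} (_ : DifferentiableAt ℝ U x.1) (δ : ℝ) (v : E × ℝ),
      fderiv ℝ (fun y : E × ℝ => (U y.1, δ * y.2)) x v = (fderiv ℝ U x.1 v.1, δ * v.2) := by
    intro U hU δ v
    have h1 : HasFDerivAt (fun y : E × ℝ => (U y.1, δ * y.2))
        (((fderiv ℝ U x.1).comp (ContinuousLinearMap.fst ℝ E ℝ)).prod
          (δ • ContinuousLinearMap.snd ℝ E ℝ)) x :=
      (hU.hasFDerivAt.comp x hasFDerivAt_fst).prodMk (hasFDerivAt_snd.const_mul δ)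
    rw [h1.fderiv]
    rfl
  simp only [VectorField.lieBracket, key hV, key hW, Prod.mk_sub_mk, Prod.mk.injEq, true_and]
  ring

theorem mlieBracket_prodField [CompleteSpace E] {X Y : ∀ p : M, TangentSpace 𝓘(ℝ, E) p}
    {q : M × ℝ}
    (hX : MDifferentiableAt 𝓘(ℝ, E) 𝓘(ℝ, E).tangent
      (fun p => (⟨p, X p⟩ : TangentBundle 𝓘(ℝ, E) M)) q.1)
    (hY : MDifferentiableAt 𝓘(ℝ, E) 𝓘(ℝ, E).tangent
      (fun p => (⟨p, Y p⟩ : TangentBundle 𝓘(ℝ, E) M)) q.1) (β γ : ℝ) :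
    VectorField.mlieBracket (𝓘(ℝ, E).prod 𝓘(ℝ, ℝ)) (prodField X β) (prodField Y γ) q =
      coneVec q (bracket X Y q.1) 0 := by
  have : IsManifold 𝓘(ℝ, E) 1 M := IsManifold.of_le (n := ∞) (by simp)
  have : IsManifold 𝓘(ℝ, E) 2 M :=
    IsManifold.of_le (n := ∞) (WithTop.coe_le_coe.2 (le_top : (2 : ℕ∞) ≤ ⊤))
  have hq : extChartAt (𝓘(ℝ, E).prod 𝓘(ℝ, ℝ)) q q = (extChartAt 𝓘(ℝ, E) q.1 q.1, q.2) := by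
    rw [extChartAt_prod]; rfl
  rw [mlieBracket_eq_lieBracket_chartRep, bracket, mlieBracket_eq_lieBracket_chartRep]
  refine ((chartRep_prodField X β q).lieBracket_vectorField_eq (chartRep_prodField Y γ q)).trans ?_
  rw [hq]
  exact lieBracket_prod_linear (x := (extChartAt 𝓘(ℝ, E) q.1 q.1, q.2))
    (differentiableAt_chartRep hX) (differentiableAt_chartRep hY) β γ

end ProductBracket

/-! ### Local frames, and tensors applied to fields along a map -/

section LocalFrames

section Along

variable {H F N : Type*} [NormedAddCommGroup F] [NormedSpace ℝ F]
  [TopologicalSpace H] {I : ModelWithCorners ℝ F H} [TopologicalSpace N] [ChartedSpace H N]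
  [FiniteDimensional ℝ E] [T2Space M]

/-- Near each point, tangent vectors are combinations of smooth vector fields with coefficients
given by the preferred trivialization. -/
theorem exists_smoothVF_frame (p : M) :
    ∃ e : Fin (Module.finrank ℝ E) → SmoothVF E M, ∀ᶠ q in 𝓝 p,
      ∀ v : TangentSpace 𝓘(ℝ, E) q, v = ∑ i, (Module.finBasis ℝ E).repr
        (trivializationAt E (fun p : M => TangentSpace 𝓘(ℝ, E) p) p ⟨q, v⟩).2 i • e i q := by
  let b := Module.finBasis ℝ E
  let t := trivializationAt E (fun p : M => TangentSpace 𝓘(ℝ, E) p) p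
  have hp : p ∈ t.baseSet := FiberBundle.mem_baseSet_trivializationAt' p
  have he : ∀ i, ∃ X : SmoothVF E M, ∀ᶠ q in 𝓝 p, X q = t.localFrame b i q := fun i =>
    SmoothVF.exists_eventuallyEq t.open_baseSet (t.contMDiffOn_localFrame_baseSet ∞ b i) hp
  choose e he using he
  refine ⟨e, ?_⟩
  filter_upwards [Filter.eventually_all.2 he, t.open_baseSet.mem_nhds hp] with q hq hqb v
  have h1 : (t.basisAt b hqb).repr v = b.repr (t ⟨q, v⟩).2 := by
    simp [Bundle.Trivialization.basisAt]
  refine ((t.basisAt b hqb).sum_repr v).symm.trans (Finset.sum_congr rfl fun i _ => ?_)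
  rw [hq i, t.localFrame_apply_of_mem_baseSet b hqb, h1]

/-- A differentiable vector field along a map `f` is, near each point, a combination of smooth
vector fields on the target with differentiable coefficients. -/
theorem exists_eventuallyEq_sum_smul {f : N → M} {v : ∀ x : N, TangentSpace 𝓘(ℝ, E) (f x)} {x : N}
    (hv : MDifferentiableAt I 𝓘(ℝ, E).tangent
      (fun y => (⟨f y, v y⟩ : TangentBundle 𝓘(ℝ, E) M)) x) :
    ∃ (e : Fin (Module.finrank ℝ E) → SmoothVF E M) (c : Fin (Module.finrank ℝ E) → N → ℝ),
      (∀ i, MDifferentiableAt I 𝓘(ℝ, ℝ) (c i) x) ∧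
      ∀ᶠ y in 𝓝 x, v y = ∑ i, c i y • e i (f y) := by
  have h := (mdifferentiableAt_totalSpace 𝓘(ℝ, E) _).1 hv
  obtain ⟨e, he⟩ := exists_smoothVF_frame (E := E) (f x)
  refine ⟨e, _, fun i => ?_, (h.1.continuousAt.eventually he).mono fun y hy => hy (v y)⟩
  exact (((Module.finBasis ℝ E).coord i).toContinuousLinearMap.mdifferentiableAt).comp x h.2

/-- Applying a smooth `1`-form to a differentiable vector field along a map. -/
theorem OneForm.mdifferentiableAt_apply (η : OneForm E M) {f : N → M}
    {v : ∀ x : N, TangentSpace 𝓘(ℝ, E) (f x)} {x : N}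
    (hv : MDifferentiableAt I 𝓘(ℝ, E).tangent
      (fun y => (⟨f y, v y⟩ : TangentBundle 𝓘(ℝ, E) M)) x) :
    MDifferentiableAt I 𝓘(ℝ, ℝ) (fun y => η (f y) (v y)) x := by
  obtain ⟨e, c, hc, h⟩ := exists_eventuallyEq_sum_smul hv
  have hf : MDifferentiableAt I 𝓘(ℝ, E) f x := ((mdifferentiableAt_totalSpace 𝓘(ℝ, E) _).1 hv).1
  have : MDifferentiableAt I 𝓘(ℝ, ℝ) (∑ i, fun y => c i y * η (f y) (e i (f y))) x := by
    refine MDifferentiableAt.sum fun i _ => (hc i).mul ?_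
    exact (((η.smooth (e i)).mdifferentiableAt (by simp)).comp x hf :)
  refine this.congr_of_eventuallyEq ?_
  filter_upwards [h] with y hy
  simp only [hy, map_sum, map_smul, smul_eq_mul, Finset.sum_apply]

/-- Applying a smooth endomorphism field to a differentiable vector field along a map. -/
theorem EndoField.mdifferentiableAt_apply (Φ : EndoField E M) {f : N → M}
    {v : ∀ x : N, TangentSpace 𝓘(ℝ, E) (f x)} {x : N}
    (hv : MDifferentiableAt I 𝓘(ℝ, E).tangent
      (fun y => (⟨f y, v y⟩ : TangentBundle 𝓘(ℝ, E) M)) x) :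
    MDifferentiableAt I 𝓘(ℝ, E).tangent
      (fun y => (⟨f y, Φ (f y) (v y)⟩ : TangentBundle 𝓘(ℝ, E) M)) x := by
  obtain ⟨e, c, hc, h⟩ := exists_eventuallyEq_sum_smul hv
  have hf : MDifferentiableAt I 𝓘(ℝ, E) f x := ((mdifferentiableAt_totalSpace 𝓘(ℝ, E) _).1 hv).1
  let t := trivializationAt E (fun p : M => TangentSpace 𝓘(ℝ, E) p) (f x)
  have hx : f x ∈ t.baseSet := FiberBundle.mem_baseSet_trivializationAt' (f x)
  refine (mdifferentiableAt_totalSpace 𝓘(ℝ, E) _).2 ⟨hf, ?_⟩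
  have : MDifferentiableAt I 𝓘(ℝ, E)
      (∑ i, fun y => c i y • (t ⟨f y, Φ (f y) (e i (f y))⟩).2) x := by
    refine MDifferentiableAt.sum fun i _ => ?_
    have h1 := (mdifferentiableAt_totalSpace 𝓘(ℝ, E) _).1
      (((Φ.smooth (e i)).mdifferentiableAt (x := f x) (by simp)).comp x hf)
    exact (hc i).smul h1.2
  refine this.congr_of_eventuallyEq ?_
  filter_upwards [h, hf.continuousAt.eventually (t.open_baseSet.mem_nhds hx)] with y hy hyb
  change (t ⟨f y, Φ (f y) (v y)⟩).2 = _
  have hl : ∀ w, (t ⟨f y, w⟩).2 = t.linearEquivAt ℝ (f y) hyb w := fun w => rfl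
  simp only [hl, hy, map_sum, map_smul, Finset.sum_apply]

end Along

end LocalFrames

/-! ### The Nijenhuis tensor of the cone and its tensoriality -/

section Nijenhuis

/-- Differentiability of `v + a ∂_r` at a point of `M × ℝ`. -/
theorem mdifferentiableAt_coneVec {v : ∀ q : M × ℝ, TangentSpace 𝓘(ℝ, E) q.1} {a : M × ℝ → ℝ}
    {q : M × ℝ}
    (hv : MDifferentiableAt (𝓘(ℝ, E).prod 𝓘(ℝ, ℝ)) 𝓘(ℝ, E).tangent
      (fun q : M × ℝ => (⟨q.1, v q⟩ : TangentBundle 𝓘(ℝ, E) M)) q)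
    (ha : MDifferentiableAt (𝓘(ℝ, E).prod 𝓘(ℝ, ℝ)) 𝓘(ℝ, ℝ) a q) :
    MDifferentiableAt (𝓘(ℝ, E).prod 𝓘(ℝ, ℝ)) (𝓘(ℝ, E).prod 𝓘(ℝ, ℝ)).tangent
      (fun q => (⟨q, coneVec q (v q) (a q)⟩ :
        TangentBundle (𝓘(ℝ, E).prod 𝓘(ℝ, ℝ)) (M × ℝ))) q := by
  have : IsManifold 𝓘(ℝ, E) 1 M := IsManifold.of_le (n := ∞) (by simp)
  have h2 : MDifferentiableAt (𝓘(ℝ, E).prod 𝓘(ℝ, ℝ)) 𝓘(ℝ, ℝ).tangent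
      (fun q : M × ℝ => (⟨q.2, a q⟩ : TangentBundle 𝓘(ℝ, ℝ) ℝ)) q := by
    refine (mdifferentiableAt_totalSpace 𝓘(ℝ, ℝ) _).2 ⟨mdifferentiableAt_snd, ?_⟩
    simpa using ha
  exact ((contMDiff_equivTangentBundleProd_symm (I := 𝓘(ℝ, E)) (M := M) (I' := 𝓘(ℝ, ℝ)) (M' := ℝ)
    (n := 1)).mdifferentiableAt (by simp)).comp q (hv.prodMk h2)

theorem contMDiff_prodField (X : SmoothVF E M) (β : ℝ) :
    ContMDiff (𝓘(ℝ, E).prod 𝓘(ℝ, ℝ)) (𝓘(ℝ, E).prod 𝓘(ℝ, ℝ)).tangent ∞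
      (fun q => (⟨q, prodField X β q⟩ : TangentBundle (𝓘(ℝ, E).prod 𝓘(ℝ, ℝ)) (M × ℝ))) := by
  have : IsManifold 𝓘(ℝ, E) 1 M := IsManifold.of_le (n := ∞) (by simp)
  have h2 : ContMDiff (𝓘(ℝ, E).prod 𝓘(ℝ, ℝ)) 𝓘(ℝ, ℝ).tangent ∞
      (fun q : M × ℝ => (⟨q.2, β * q.2⟩ : TangentBundle 𝓘(ℝ, ℝ) ℝ)) := by
    intro q
    refine Bundle.contMDiffAt_totalSpace.2 ⟨contMDiffAt_snd, ?_⟩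
    have h := (contMDiffAt_const (c := β)).mul
      (contMDiffAt_snd (I := 𝓘(ℝ, E)) (J := 𝓘(ℝ, ℝ)) (n := ∞) (p := q))
    simpa using! h
  exact (contMDiff_equivTangentBundleProd_symm (I := 𝓘(ℝ, E)) (M := M) (I' := 𝓘(ℝ, ℝ)) (M' := ℝ)
    (n := ∞)).comp ((X.contMDiff.comp contMDiff_fst).prodMk h2)

variable {X : ConeVF E M} {q : M × ℝ}

theorem mdifferentiableAt_horPart
    (hX : MDifferentiableAt (𝓘(ℝ, E).prod 𝓘(ℝ, ℝ)) (𝓘(ℝ, E).prod 𝓘(ℝ, ℝ)).tangent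
      (fun q => (⟨q, X q⟩ : TangentBundle (𝓘(ℝ, E).prod 𝓘(ℝ, ℝ)) (M × ℝ))) q) :
    MDifferentiableAt (𝓘(ℝ, E).prod 𝓘(ℝ, ℝ)) 𝓘(ℝ, E).tangent
      (fun q : M × ℝ => (⟨q.1, horPart q (X q)⟩ : TangentBundle 𝓘(ℝ, E) M)) q := by
  have : IsManifold 𝓘(ℝ, E) 1 M := IsManifold.of_le (n := ∞) (by simp)
  exact (((contMDiff_equivTangentBundleProd (I := 𝓘(ℝ, E)) (M := M) (I' := 𝓘(ℝ, ℝ)) (M' := ℝ)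
    (n := 1)).mdifferentiableAt (by simp)).comp q hX).fst

theorem mdifferentiableAt_radPart
    (hX : MDifferentiableAt (𝓘(ℝ, E).prod 𝓘(ℝ, ℝ)) (𝓘(ℝ, E).prod 𝓘(ℝ, ℝ)).tangent
      (fun q => (⟨q, X q⟩ : TangentBundle (𝓘(ℝ, E).prod 𝓘(ℝ, ℝ)) (M × ℝ))) q) :
    MDifferentiableAt (𝓘(ℝ, E).prod 𝓘(ℝ, ℝ)) 𝓘(ℝ, ℝ) (fun q => radPart q (X q)) q := by
  have : IsManifold 𝓘(ℝ, E) 1 M := IsManifold.of_le (n := ∞) (by simp)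
  have h := (((contMDiff_equivTangentBundleProd (I := 𝓘(ℝ, E)) (M := M) (I' := 𝓘(ℝ, ℝ)) (M' := ℝ)
    (n := 1)).mdifferentiableAt (by simp)).comp q hX).snd
  exact (((contMDiff_snd_tangentBundle_modelSpace ℝ 𝓘(ℝ, ℝ) (n := 1)).mdifferentiableAt
    (by simp)).comp q h :)

variable (ξ : SmoothVF E M) (η : OneForm E M) (Φ : EndoField E M)

/-- The horizontal part of a cone field depends on `r`: it is a field along the projection to `M`,
not a field on `M`. This is why `η` and `Φ` are handled by frames along a map. The result supplies
the differentiability needed for Leibniz rules involving `IX`. -/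
theorem mdifferentiableAt_coneI [FiniteDimensional ℝ E] [T2Space M] (hq : q ∈ cone M)
    (hX : MDifferentiableAt (𝓘(ℝ, E).prod 𝓘(ℝ, ℝ)) (𝓘(ℝ, E).prod 𝓘(ℝ, ℝ)).tangent
      (fun q => (⟨q, X q⟩ : TangentBundle (𝓘(ℝ, E).prod 𝓘(ℝ, ℝ)) (M × ℝ))) q) :
    MDifferentiableAt (𝓘(ℝ, E).prod 𝓘(ℝ, ℝ)) (𝓘(ℝ, E).prod 𝓘(ℝ, ℝ)).tangent
      (fun q => (⟨q, coneI ξ η Φ X q⟩ : TangentBundle (𝓘(ℝ, E).prod 𝓘(ℝ, ℝ)) (M × ℝ))) q := by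
  have hh := mdifferentiableAt_horPart hX
  have hr := mdifferentiableAt_radPart hX
  have hs : MDifferentiableAt (𝓘(ℝ, E).prod 𝓘(ℝ, ℝ)) 𝓘(ℝ, ℝ) (fun q : M × ℝ => q.2) q :=
    mdifferentiableAt_snd
  have hx : MDifferentiableAt (𝓘(ℝ, E).prod 𝓘(ℝ, ℝ)) 𝓘(ℝ, E).tangent
      (fun q : M × ℝ => (⟨q.1, ξ q.1⟩ : TangentBundle 𝓘(ℝ, E) M)) q :=
    (ξ.mdifferentiableAt q.1).comp q mdifferentiableAt_fst
  have hd : MDifferentiableAt (𝓘(ℝ, E).prod 𝓘(ℝ, ℝ)) 𝓘(ℝ, ℝ)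
      (fun q => radPart q (X q) / q.2) q := by
    simp only [div_eq_mul_inv]
    exact hr.mul ((differentiableAt_inv (ne_of_gt hq)).mdifferentiableAt.comp q hs)
  refine mdifferentiableAt_coneVec ?_ ((η.mdifferentiableAt_apply hh).mul hs)
  have hΦ := Φ.mdifferentiableAt_apply hh
  let t := trivializationAt E (fun p : M => TangentSpace 𝓘(ℝ, E) p) q.1
  have ht : q.1 ∈ t.baseSet := FiberBundle.mem_baseSet_trivializationAt' q.1
  refine (mdifferentiableAt_totalSpace 𝓘(ℝ, E) _).2 ⟨mdifferentiableAt_fst, ?_⟩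
  have := ((mdifferentiableAt_totalSpace 𝓘(ℝ, E) _).1 hΦ).2.sub
    (hd.smul ((mdifferentiableAt_totalSpace 𝓘(ℝ, E) _).1 hx).2)
  refine this.congr_of_eventuallyEq ?_
  filter_upwards [(continuous_fst.continuousAt (x := q)).eventually
    (t.open_baseSet.mem_nhds ht)] with y hyb
  have hl : ∀ w, (t ⟨y.1, w⟩).2 = t.linearEquivAt ℝ y.1 hyb w := fun w => rfl
  change (t ⟨y.1, _⟩).2 = (t ⟨y.1, _⟩).2 - (_ : ℝ) • (t ⟨y.1, _⟩).2
  simp only [hl, map_sub, map_smul]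

/-- The almost complex structure of the cone on a single tangent space. -/
def coneIAt (q : M × ℝ) : TangentSpace (𝓘(ℝ, E).prod 𝓘(ℝ, ℝ)) q →ₗ[ℝ]
    TangentSpace (𝓘(ℝ, E).prod 𝓘(ℝ, ℝ)) q where
  toFun w := coneVec q (Φ q.1 (horPart q w) - (radPart q w / q.2) • ξ q.1)
    (η q.1 (horPart q w) * q.2)
  map_add' u v := by
    have h1 : horPart q (u + v) = horPart q u + horPart q v := rfl
    have h2 : radPart q (u + v) = radPart q u + radPart q v := rfl
    rw [h1, h2, map_add, map_add, add_div, add_smul, add_mul, add_sub_add_comm]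
    rfl
  map_smul' c v := by
    have h1 : horPart q (c • v) = c • horPart q v := rfl
    have h2 : radPart q (c • v) = c * radPart q v := rfl
    rw [h1, h2, map_smul, map_smul, mul_div_assoc, mul_smul, ← smul_sub, smul_eq_mul, mul_assoc]
    rfl

theorem coneI_apply (X : ConeVF E M) (q : M × ℝ) : coneI ξ η Φ X q = coneIAt ξ η Φ q (X q) := rfl

/-- The Nijenhuis tensor of the almost complex structure on the cone. -/
def nijenhuis (X Y : ConeVF E M) (q : M × ℝ) : TangentSpace (𝓘(ℝ, E).prod 𝓘(ℝ, ℝ)) q :=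
  VectorField.mlieBracket (𝓘(ℝ, E).prod 𝓘(ℝ, ℝ)) (coneI ξ η Φ X) (coneI ξ η Φ Y) q
    - coneIAt ξ η Φ q
      (VectorField.mlieBracket (𝓘(ℝ, E).prod 𝓘(ℝ, ℝ)) (coneI ξ η Φ X) Y q)
    - coneIAt ξ η Φ q
      (VectorField.mlieBracket (𝓘(ℝ, E).prod 𝓘(ℝ, ℝ)) X (coneI ξ η Φ Y) q)
    - VectorField.mlieBracket (𝓘(ℝ, E).prod 𝓘(ℝ, ℝ)) X Y q

theorem nijenhuis_swap (X Y : ConeVF E M) (q : M × ℝ) :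
    nijenhuis ξ η Φ X Y q = -nijenhuis ξ η Φ Y X q := by
  unfold nijenhuis
  rw [VectorField.mlieBracket_swap_apply (V := coneI ξ η Φ X) (W := coneI ξ η Φ Y),
    VectorField.mlieBracket_swap_apply (V := coneI ξ η Φ X) (W := Y),
    VectorField.mlieBracket_swap_apply (V := X) (W := coneI ξ η Φ Y),
    VectorField.mlieBracket_swap_apply (V := X) (W := Y), map_neg, map_neg]
  abel

variable [FiniteDimensional ℝ E] [CompleteSpace E] [T2Space M] {ξ η Φ}

/-- Replacing `X` by `fX` produces the extra terms `∓(IY f) IX` and `∓(Y f) X`, which cancel in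
pairs because `I² = -1`. -/
theorem tensorialAt_nijenhuis_left (hq : q ∈ cone M)
    (hI : ∀ w, coneIAt ξ η Φ q (coneIAt ξ η Φ q w) = -w) (Y : ConeVF E M) :
    TensorialAt (𝓘(ℝ, E).prod 𝓘(ℝ, ℝ)) (E × ℝ) (fun X => nijenhuis ξ η Φ X Y q) q := by
  refine ⟨fun {f X} hf hX => ?_, fun {X X'} hX hX' => ?_⟩
  · have hs : coneI ξ η Φ (f • X) = f • coneI ξ η Φ X := by
      funext y
      exact (coneIAt ξ η Φ y).map_smul (f y) (X y)
    have hIX := mdifferentiableAt_coneI ξ η Φ hq hX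
    unfold nijenhuis
    rw [hs, VectorField.mlieBracket_smul_left hf hIX, VectorField.mlieBracket_smul_left hf hIX,
      VectorField.mlieBracket_smul_left hf hX, VectorField.mlieBracket_smul_left hf hX]
    simp only [map_add, map_smul, coneI_apply, hI]
    module
  · have hs : coneI ξ η Φ (X + X') = coneI ξ η Φ X + coneI ξ η Φ X' := by
      funext y
      exact (coneIAt ξ η Φ y).map_add (X y) (X' y)
    have hIX := mdifferentiableAt_coneI ξ η Φ hq hX
    have hIX' := mdifferentiableAt_coneI ξ η Φ hq hX'
    unfold nijenhuis
    rw [hs, VectorField.mlieBracket_add_left hIX hIX', VectorField.mlieBracket_add_left hIX hIX',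
      VectorField.mlieBracket_add_left hX hX', VectorField.mlieBracket_add_left hX hX']
    simp only [map_add]
    abel

/-- The Nijenhuis tensor depends only on the values of the vector fields at the point. -/
theorem nijenhuis_congr (hq : q ∈ cone M)
    (hI : ∀ w, coneIAt ξ η Φ q (coneIAt ξ η Φ q w) = -w) {X X' Y Y' : ConeVF E M}
    (hX : MDifferentiableAt (𝓘(ℝ, E).prod 𝓘(ℝ, ℝ)) (𝓘(ℝ, E).prod 𝓘(ℝ, ℝ)).tangent
      (fun q => (⟨q, X q⟩ : TangentBundle (𝓘(ℝ, E).prod 𝓘(ℝ, ℝ)) (M × ℝ))) q)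
    (hX' : MDifferentiableAt (𝓘(ℝ, E).prod 𝓘(ℝ, ℝ)) (𝓘(ℝ, E).prod 𝓘(ℝ, ℝ)).tangent
      (fun q => (⟨q, X' q⟩ : TangentBundle (𝓘(ℝ, E).prod 𝓘(ℝ, ℝ)) (M × ℝ))) q)
    (hY : MDifferentiableAt (𝓘(ℝ, E).prod 𝓘(ℝ, ℝ)) (𝓘(ℝ, E).prod 𝓘(ℝ, ℝ)).tangent
      (fun q => (⟨q, Y q⟩ : TangentBundle (𝓘(ℝ, E).prod 𝓘(ℝ, ℝ)) (M × ℝ))) q)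
    (hY' : MDifferentiableAt (𝓘(ℝ, E).prod 𝓘(ℝ, ℝ)) (𝓘(ℝ, E).prod 𝓘(ℝ, ℝ)).tangent
      (fun q => (⟨q, Y' q⟩ : TangentBundle (𝓘(ℝ, E).prod 𝓘(ℝ, ℝ)) (M × ℝ))) q)
    (hXX' : X q = X' q) (hYY' : Y q = Y' q) :
    nijenhuis ξ η Φ X Y q = nijenhuis ξ η Φ X' Y' q := by
  rw [(tensorialAt_nijenhuis_left hq hI Y).pointwise hX hX' hXX', nijenhuis_swap,
    (tensorialAt_nijenhuis_left hq hI X').pointwise hY hY' hYY', ← nijenhuis_swap]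

end Nijenhuis

/-! ### Almost contact algebra and the Nijenhuis tensor on product fields -/

section AlmostContact

section Bracket

theorem bracket_swap (X Y : SmoothVF E M) (p : M) :
    bracket X Y p = -bracket Y X p :=
  VectorField.mlieBracket_swap_apply

theorem bracket_self (X : SmoothVF E M) (p : M) : bracket X X p = 0 := by
  have h : (2 : ℝ) • bracket X X p = 0 := by
    rw [two_smul]
    exact add_eq_zero_iff_eq_neg.2 (bracket_swap X X p)
  exact (smul_eq_zero.1 h).resolve_left two_ne_zero

variable [CompleteSpace E]

theorem bracket_add_right (X Y Z : SmoothVF E M) (p : M) :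
    bracket X (Y + Z : SmoothVF E M) p = bracket X Y p + bracket X Z p :=
  VectorField.mlieBracket_add_right (Y.mdifferentiableAt p) (Z.mdifferentiableAt p)

theorem bracket_smul_right (t : ℝ) (X Y : SmoothVF E M) (p : M) :
    bracket X (t • Y : SmoothVF E M) p = t • bracket X Y p :=
  VectorField.mlieBracket_const_smul_right (Y.mdifferentiableAt p)

theorem bracket_add_smul_add_smul (X Y Z : SmoothVF E M) (a b : ℝ) (p : M) :
    bracket (X + a • Z : SmoothVF E M) (Y + b • Z : SmoothVF E M) p =
      bracket X Y p + a • bracket Z Y p - b • bracket Z X p := by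
  rw [CRStructure.bracket_add_left, CRStructure.bracket_smul_left, bracket_add_right,
    bracket_add_right, bracket_smul_right, bracket_smul_right, bracket_self, bracket_swap X Z]
  module

theorem bracket_fsmul_right (X Y : SmoothVF E M) {f : M → ℝ} (hf : IsSmoothFun E f) (p : M) :
    bracket X (SmoothVF.fsmul f hf Y) p =
      mvfderiv 𝓘(ℝ, E) f p (X p) • Y p + f p • bracket X Y p :=
  VectorField.mlieBracket_smul_right (hf.mdifferentiableAt (by simp)) (Y.mdifferentiableAt p)

end Bracket

/-- The vector field `Φ X`. -/
def EndoField.apply (Φ : EndoField E M) (X : SmoothVF E M) : SmoothVF E M :=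
  ⟨fun p => Φ p (X p), Φ.smooth X⟩

section AlmostContact

variable {ξ : SmoothVF E M} {η : OneForm E M} {Φ : EndoField E M}

/-- Since `Φ²ξ = 0`, the formula for `Φ²` at `Φξ` gives `Φξ = aξ`; then `a²ξ = 0` with `ξ ≠ 0`. -/
theorem phi_xi_eq_zero (h1 : ∀ p, η p (ξ p) = 1)
    (h2 : ∀ p v, Φ p (Φ p v) = -v + η p v • ξ p) (p : M) : Φ p (ξ p) = 0 := by
  have hξ : ξ p ≠ 0 := fun h => by
    have := h1 p
    rw [h, map_zero] at this
    exact zero_ne_one this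
  have h3 : Φ p (Φ p (ξ p)) = 0 := by rw [h2, h1, one_smul, neg_add_cancel]
  have h4 : Φ p (ξ p) = η p (Φ p (ξ p)) • ξ p := by
    have := h2 p (Φ p (ξ p))
    rw [h3, map_zero] at this
    exact (neg_add_eq_zero.1 this.symm)
  generalize η p (Φ p (ξ p)) = a at h4
  rw [h4, map_smul, h4, smul_smul, smul_eq_zero, mul_self_eq_zero] at h3
  rw [h4, h3.resolve_right hξ, zero_smul]

/-- Compute `Φ³v` as `Φ²(Φv)` and as `Φ(Φ²v)`: the difference is `η(Φv) ξ`. -/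
theorem eta_phi_eq_zero (h1 : ∀ p, η p (ξ p) = 1)
    (h2 : ∀ p v, Φ p (Φ p v) = -v + η p v • ξ p) (p : M) (v : TangentSpace 𝓘(ℝ, E) p) :
    η p (Φ p v) = 0 := by
  have h3 := h2 p (Φ p v)
  rw [h2 p v, map_add, map_neg, map_smul, phi_xi_eq_zero h1 h2, smul_zero, add_zero] at h3
  have h4 := congrArg (η p) (left_eq_add.1 h3)
  rwa [map_smul, h1, map_zero, smul_eq_mul, mul_one] at h4

theorem coneIAt_sq (h1 : ∀ p, η p (ξ p) = 1)
    (h2 : ∀ p v, Φ p (Φ p v) = -v + η p v • ξ p) {q : M × ℝ} (hq : q ∈ cone M)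
    (w : TangentSpace (𝓘(ℝ, E).prod 𝓘(ℝ, ℝ)) q) :
    coneIAt ξ η Φ q (coneIAt ξ η Φ q w) = -w := by
  have hr : q.2 ≠ 0 := ne_of_gt hq
  have hw : w = coneVec q (horPart q w) (radPart q w) := rfl
  have hI : ∀ v a, coneIAt ξ η Φ q (coneVec q v a) =
    coneVec q (Φ q.1 v - (a / q.2) • ξ q.1) (η q.1 v * q.2) := fun v a => rfl
  rw [hw, hI, hI, map_sub, map_sub, map_smul, map_smul, h2, phi_xi_eq_zero h1 h2,
    eta_phi_eq_zero h1 h2, h1, mul_div_cancel_right₀ _ hr, smul_eq_mul, mul_one, zero_sub,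
    neg_mul, div_mul_cancel₀ _ hr, smul_zero, sub_zero, add_sub_cancel_right]
  rfl

/-- Fields with `η(X)` constant are singled out because `I` keeps them of the form `X + β r∂_r` with
constant `β`. Equality needs `r ≠ 0`, and equality near the point is enough for brackets. -/
theorem coneI_prodField_eventuallyEq {X : SmoothVF E M} {b : ℝ} (hX : ∀ p, η p (X p) = b) (β : ℝ)
    {q : M × ℝ} (hq : q ∈ cone M) :
    coneI ξ η Φ (prodField X β) =ᶠ[𝓝 q] prodField (Φ.apply X + (-β) • ξ : SmoothVF E M) b := by
  have ho : IsOpen (cone M) := isOpen_lt continuous_const continuous_snd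
  filter_upwards [ho.mem_nhds hq] with y hy
  have hr : y.2 ≠ 0 := ne_of_gt hy
  change coneVec y (Φ y.1 (X y.1) - (β * y.2 / y.2) • ξ y.1) (η y.1 (X y.1) * y.2) =
    coneVec y (Φ y.1 (X y.1) + (-β) • ξ y.1) (b * y.2)
  rw [mul_div_cancel_right₀ _ hr, hX, neg_smul, sub_eq_add_neg]

/-- All four brackets have zero radial part, so the constants `b` and `c` disappear and only
brackets on `M` remain. -/
theorem nijenhuis_prodField [CompleteSpace E] {X Y : SmoothVF E M} {b c : ℝ}
    (hX : ∀ p, η p (X p) = b)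
    (hY : ∀ p, η p (Y p) = c) (β γ : ℝ) {q : M × ℝ} (hq : q ∈ cone M) :
    nijenhuis ξ η Φ (prodField X β) (prodField Y γ) q =
      coneVec q (bracket (Φ.apply X + (-β) • ξ : SmoothVF E M)
          (Φ.apply Y + (-γ) • ξ : SmoothVF E M) q.1
        - Φ q.1 (bracket (Φ.apply X + (-β) • ξ : SmoothVF E M) Y q.1
          + bracket X (Φ.apply Y + (-γ) • ξ : SmoothVF E M) q.1) - bracket X Y q.1)
        (-(η q.1 (bracket (Φ.apply X + (-β) • ξ : SmoothVF E M) Y q.1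
          + bracket X (Φ.apply Y + (-γ) • ξ : SmoothVF E M) q.1)) * q.2) := by
  have eX := coneI_prodField_eventuallyEq (ξ := ξ) (Φ := Φ) hX β hq
  have eY := coneI_prodField_eventuallyEq (ξ := ξ) (Φ := Φ) hY γ hq
  have hI : ∀ v, coneIAt ξ η Φ q (coneVec q v 0) = coneVec q (Φ q.1 v) (η q.1 v * q.2) := by
    intro v
    change coneVec q (Φ q.1 v - ((0 : ℝ) / q.2) • ξ q.1) (η q.1 v * q.2) = _
    rw [zero_div, zero_smul, sub_zero]
  have hsub : ∀ (v w : TangentSpace 𝓘(ℝ, E) q.1) (a b : ℝ),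
      coneVec q v a - coneVec q w b = coneVec q (v - w) (a - b) :=
    fun v w a b => rfl
  unfold nijenhuis
  have e := fun (X : SmoothVF E M) (β : ℝ) => Filter.EventuallyEq.refl (𝓝 q) (prodField X β)
  have hb := fun (X Y : SmoothVF E M) (β γ : ℝ) =>
    mlieBracket_prodField (q := q) (X.mdifferentiableAt q.1) (Y.mdifferentiableAt q.1) β γ
  rw [(eX.mlieBracket_vectorField_eq eY).trans (hb _ _ _ _),
    (eX.mlieBracket_vectorField_eq (e Y γ)).trans (hb _ _ _ _),
    ((e X β).mlieBracket_vectorField_eq eY).trans (hb _ _ _ _), hb,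
    hI, hI, hsub, hsub, hsub, map_add, map_add]
  congr 1
  · abel
  · ring

end AlmostContact

end AlmostContact

/-! ### Normality is equivalent to `£_ξ J = 0` -/

section Normality

namespace CRStructure

variable {C : CRStructure E M} {ξ : SmoothVF E M} {η : OneForm E M} {Φ : EndoField E M}

theorem Represents.mem_iff (hη : C.Represents η) {p : M} {v : TangentSpace 𝓘(ℝ, E) p} :
    v ∈ C.D p ↔ η p v = 0 := by
  rw [← hη p, LinearMap.mem_ker]

theorem coe_J_apply_eq (hJ : ∀ (p : M) (v : C.D p), Φ p v = C.J p v) {p : M}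
    {v : TangentSpace 𝓘(ℝ, E) p} (hv : v ∈ C.D p) :
    ((C.J p ⟨v, hv⟩ : C.D p) : TangentSpace 𝓘(ℝ, E) p) = Φ p v := (hJ p ⟨v, hv⟩).symm

theorem applyJ_eq_apply (hJ : ∀ (p : M) (v : C.D p), Φ p v = C.J p v) {X : SmoothVF E M}
    (hX : C.IsSection X) : C.applyJ X hX = Φ.apply X := by
  ext p
  exact coe_J_apply_eq hJ (hX p)

/-- Normality implies that the Reeb field preserves the CR structure. -/
theorem preservesJ_of_isNormal [CompleteSpace E]
    (hη : C.Represents η) (hJ : ∀ (p : M) (v : C.D p), Φ p v = C.J p v)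
    (hξ : ∀ Y : SmoothVF E M, C.IsSection Y → ∀ p, η p (bracket ξ Y p) = 0)
    (hN : IsNormal ξ η Φ) : C.PreservesJ ξ := by
  intro Y hY p
  have hmem : bracket ξ Y p ∈ C.D p := hη.mem_iff.2 (hξ Y hY p)
  refine ⟨hmem, ?_⟩
  rw [applyJ_eq_apply hJ hY, coe_J_apply_eq hJ hmem]
  have hq : ((p, 1) : M × ℝ) ∈ cone M := show (0 : ℝ) < 1 from one_pos
  -- The test pair is `Y` and `r∂_r`: here `IY = ΦY` and `I(r∂_r) = -ξ`, and the horizontal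
  -- component is `[ξ, ΦY] - Φ[ξ, Y]`.
  have h0 : nijenhuis ξ η Φ (prodField Y 0) (prodField (0 : SmoothVF E M) 1) (p, 1) = 0 :=
    hN _ _ (contMDiff_prodField Y 0).contMDiffOn
      (contMDiff_prodField (0 : SmoothVF E M) 1).contMDiffOn _ hq
  rw [nijenhuis_prodField (b := 0) (c := 0) (fun p => hη.mem_iff.1 (hY p))
    (fun p => (η p).map_zero) 0 1 hq] at h0
  have hΦ0 : Φ.apply (0 : SmoothVF E M) = 0 := by
    ext p
    exact (Φ p).map_zero
  have hb0 : ∀ X : SmoothVF E M, bracket X (0 : SmoothVF E M) p = 0 := fun X => by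
    simpa using bracket_smul_right 0 X 0 p
  have h3 : bracket (Φ.apply Y + (-0 : ℝ) • ξ : SmoothVF E M)
        (Φ.apply (0 : SmoothVF E M) + (-1 : ℝ) • ξ : SmoothVF E M) p
      - Φ p (bracket (Φ.apply Y + (-0 : ℝ) • ξ : SmoothVF E M) (0 : SmoothVF E M) p
        + bracket Y (Φ.apply (0 : SmoothVF E M) + (-1 : ℝ) • ξ : SmoothVF E M) p)
      - bracket Y (0 : SmoothVF E M) p = 0 := congrArg Prod.fst h0
  simp only [neg_zero, zero_smul, add_zero, hΦ0, zero_add, hb0, bracket_smul_right, sub_zero,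
    map_smul] at h3
  rw [bracket_swap (Φ.apply Y) ξ, bracket_swap Y ξ, map_neg] at h3
  simpa [sub_eq_zero] using h3

/-- If the Reeb field preserves the CR structure, then the almost contact structure is normal. -/
theorem isNormal_of_preservesJ [FiniteDimensional ℝ E] [CompleteSpace E] [T2Space M]
    (h1 : ∀ p, η p (ξ p) = 1) (h2 : ∀ p v, Φ p (Φ p v) = -v + η p v • ξ p)
    (hη : C.Represents η) (hJ : ∀ (p : M) (v : C.D p), Φ p v = C.J p v)
    (hξ : C.PreservesJ ξ) : IsNormal ξ η Φ := by
  -- By tensoriality it suffices to test fields `A + bξ + β r∂_r`, which realise every tangent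
  -- vector of the cone.
  have key : ∀ q ∈ cone M, ∀ w : TangentSpace (𝓘(ℝ, E).prod 𝓘(ℝ, ℝ)) q,
      ∃ (A : SmoothVF E M) (_ : C.IsSection A) (b β : ℝ),
        w = prodField (A + b • ξ : SmoothVF E M) β q := by
    intro q hq w
    have hr : q.2 ≠ 0 := ne_of_gt hq
    have hv : horPart q w - η q.1 (horPart q w) • ξ q.1 ∈ C.D q.1 := by
      rw [hη.mem_iff, map_sub, map_smul, h1, smul_eq_mul, mul_one, sub_self]
    obtain ⟨A, hA, hA'⟩ := C.smooth_D q.1 ⟨_, hv⟩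
    refine ⟨A, hA, η q.1 (horPart q w), radPart q w / q.2, ?_⟩
    change coneVec q (horPart q w) (radPart q w) = coneVec q (A q.1 + (_ : ℝ) • ξ q.1) (_ / _ * q.2)
    rw [hA', div_mul_cancel₀ _ hr, sub_add_cancel]
  have hval : ∀ (A : SmoothVF E M) (_ : C.IsSection A) (b : ℝ) (p : M),
      η p ((A + b • ξ : SmoothVF E M) p) = b := by
    intro A hA b p
    change η p (A p + b • ξ p) = b
    rw [map_add, map_smul, h1, hη.mem_iff.1 (hA p), zero_add, smul_eq_mul, mul_one]
  have hΦ : ∀ (A : SmoothVF E M) (b : ℝ), Φ.apply (A + b • ξ) = Φ.apply A := by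
    intro A b
    ext p
    change Φ p (A p + b • ξ p) = Φ p (A p)
    rw [map_add, map_smul, phi_xi_eq_zero h1 h2, smul_zero, add_zero]
  intro X Y hX hY q hq
  have ho : IsOpen (cone M) := isOpen_lt continuous_const continuous_snd
  obtain ⟨A, hA, a, α, hXA⟩ := key q hq (X q)
  obtain ⟨B, hB, b, β, hYB⟩ := key q hq (Y q)
  change nijenhuis ξ η Φ X Y q = 0
  rw [nijenhuis_congr hq (coneIAt_sq h1 h2 hq)
    ((hX.contMDiffAt (ho.mem_nhds hq)).mdifferentiableAt (by simp))
    ((contMDiff_prodField _ _).mdifferentiableAt (by simp))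
    ((hY.contMDiffAt (ho.mem_nhds hq)).mdifferentiableAt (by simp))
    ((contMDiff_prodField _ _).mdifferentiableAt (by simp)) hXA hYB,
    nijenhuis_prodField (hval A hA a) (hval B hB b) α β hq, hΦ, hΦ]
  obtain ⟨hm, hJm⟩ := C.integrable A B hA hB q.1
  obtain ⟨hmA, hA'⟩ := hξ A hA q.1
  obtain ⟨hmB, hB'⟩ := hξ B hB q.1
  rw [coe_J_apply_eq hJ] at hJm
  rw [coe_J_apply_eq hJ, applyJ_eq_apply hJ] at hA' hB'
  have eA : (fun p => ((C.J p ⟨A p, hA p⟩ : C.D p) : TangentSpace 𝓘(ℝ, E) p)) = Φ.apply A :=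
    funext fun p => coe_J_apply_eq hJ (hA p)
  have eB : (fun p => ((C.J p ⟨B p, hB p⟩ : C.D p) : TangentSpace 𝓘(ℝ, E) p)) = Φ.apply B :=
    funext fun p => coe_J_apply_eq hJ (hB p)
  rw [hη.mem_iff] at hm hmA hmB
  rw [eA, eB] at hm hJm
  -- After expansion the terms with `ξ` cancel by `[ξ, ΦA] = Φ[ξ, A]` and its analogue for `B`; what
  -- is left is the CR integrability identity for `A` and `B`, whose membership part kills the
  -- radial component.
  simp only [bracket_add_smul_add_smul, hA', hB']
  rw [map_add] at hm hJm
  simp only [map_add, map_sub, map_smul, h2, eta_phi_eq_zero h1 h2, hmA, hmB, smul_eq_mul,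
    mul_zero, zero_smul, add_zero, sub_zero, hm, neg_zero, zero_mul]
  have h3 : bracket (Φ.apply A) (Φ.apply B) q.1 = Φ q.1 (bracket (Φ.apply A) B q.1)
      + Φ q.1 (bracket A (Φ.apply B) q.1) + bracket A B q.1 := by
    rw [hJm, sub_add_cancel]
  rw [h3]
  have hc : ∀ v : TangentSpace 𝓘(ℝ, E) q.1, v = 0 → coneVec q v 0 = 0 := by
    rintro _ rfl
    rfl
  refine hc _ ?_
  module

end CRStructure

end Normality

/-! ### Splitting along `𝒟 ⊕ ℝξ`, the exterior derivative, contact fields -/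

section Contact

namespace CRStructure

variable {C : CRStructure E M} {ξ : SmoothVF E M} {η : OneForm E M}

/-- The component `X - η(X) ξ` of a vector field along `ker η`. -/
def horizontal (ξ : SmoothVF E M) (η : OneForm E M) (X : SmoothVF E M) : SmoothVF E M :=
  X - SmoothVF.fsmul (fun p => η p (X p)) (η.smooth X) ξ

theorem horizontal_apply (X : SmoothVF E M) (p : M) :
    horizontal ξ η X p = X p - η p (X p) • ξ p := rfl

theorem eq_horizontal_add (X : SmoothVF E M) :
    X = horizontal ξ η X + SmoothVF.fsmul (fun p => η p (X p)) (η.smooth X) ξ :=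
  (sub_add_cancel _ _).symm

theorem isSection_horizontal (h1 : ∀ p, η p (ξ p) = 1) (hη : C.Represents η) (X : SmoothVF E M) :
    C.IsSection (horizontal ξ η X) := by
  intro p
  rw [hη.mem_iff, horizontal_apply, map_sub, map_smul, h1, smul_eq_mul, mul_one, sub_self]

/-- `v - η(v) ξ` lies in `𝒟`, hence is killed by `η'`. -/
theorem Represents.eq_mul (hη : C.Represents η) (h1 : ∀ p, η p (ξ p) = 1) {η' : OneForm E M}
    (hη' : C.Represents η') (p : M) (v : TangentSpace 𝓘(ℝ, E) p) :
    η' p v = η p v * η' p (ξ p) := by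
  have h : v - η p v • ξ p ∈ C.D p := by
    rw [hη.mem_iff, map_sub, map_smul, h1, smul_eq_mul, mul_one, sub_self]
  rw [hη'.mem_iff, map_sub, map_smul, sub_eq_zero] at h
  exact h

/-- Every tangent vector extends to a smooth vector field. -/
theorem exists_smoothVF_eq (h1 : ∀ p, η p (ξ p) = 1) (hη : C.Represents η) (p : M)
    (v : TangentSpace 𝓘(ℝ, E) p) : ∃ X : SmoothVF E M, X p = v := by
  have h : v - η p v • ξ p ∈ C.D p := by
    rw [hη.mem_iff, map_sub, map_smul, h1, smul_eq_mul, mul_one, sub_self]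
  obtain ⟨X, -, hX⟩ := C.smooth_D p ⟨_, h⟩
  refine ⟨X + η p v • ξ, ?_⟩
  change X p + η p v • ξ p = v
  rw [hX, sub_add_cancel]

theorem mvfderiv_eq_zero_of_const {f : M → ℝ} {a : ℝ} (h : ∀ p, f p = a) (p : M)
    (v : TangentSpace 𝓘(ℝ, E) p) : mvfderiv 𝓘(ℝ, E) f p v = 0 := by
  rw [show f = fun _ => a from funext h, mvfderiv_const]
  rfl

theorem d_of_isSection (c : ℝ) (hη : C.Represents η) {X Y : SmoothVF E M} (hX : C.IsSection X)
    (hY : C.IsSection Y) (p : M) : η.d c X Y p = -(c * η p (bracket X Y p)) := by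
  rw [OneForm.d, mvfderiv_eq_zero_of_const (fun q => hη.mem_iff.1 (hY q)),
    mvfderiv_eq_zero_of_const (fun q => hη.mem_iff.1 (hX q))]
  ring

variable [CompleteSpace E]

/-- `dη` in terms of the horizontal components, if `dη(ξ, ·) = 0`. -/
theorem d_eq_horizontal (c : ℝ) (h1 : ∀ p, η p (ξ p) = 1) (hη : C.Represents η)
    (hξ : ∀ Z : SmoothVF E M, C.IsSection Z → ∀ p, η p (bracket ξ Z p) = 0)
    (X Y : SmoothVF E M) (p : M) :
    η.d c X Y p = -(c * η p (bracket (horizontal ξ η X) (horizontal ξ η Y) p)) := by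
  have hX := isSection_horizontal h1 hη X
  have hY := isSection_horizontal h1 hη Y
  have eX : bracket (horizontal ξ η Y) X p =
      bracket (horizontal ξ η Y) (horizontal ξ η X) p
      + (mvfderiv 𝓘(ℝ, E) (fun p => η p (X p)) p (horizontal ξ η Y p) • ξ p
        + η p (X p) • bracket (horizontal ξ η Y) ξ p) := by
    conv_lhs => rw [eq_horizontal_add (ξ := ξ) (η := η) X]
    rw [bracket_add_right, bracket_fsmul_right]
  have eY : bracket X Y p = bracket X (horizontal ξ η Y) p
      + (mvfderiv 𝓘(ℝ, E) (fun p => η p (Y p)) p (X p) • ξ p + η p (Y p) • bracket X ξ p) := by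
    conv_lhs => rw [eq_horizontal_add (ξ := ξ) (η := η) Y]
    rw [bracket_add_right, bracket_fsmul_right]
  have eξ : bracket ξ X p = bracket ξ (horizontal ξ η X) p
      + (mvfderiv 𝓘(ℝ, E) (fun p => η p (X p)) p (ξ p) • ξ p + η p (X p) • bracket ξ ξ p) := by
    conv_lhs => rw [eq_horizontal_add (ξ := ξ) (η := η) X]
    rw [bracket_add_right, bracket_fsmul_right]
  -- The term `X(η(Y))` cancels at once, and `Y(η(X))` cancels against its two pieces, along the
  -- horizontal part of `Y` and along `η(Y) ξ`.
  rw [OneForm.d, eY, bracket_swap X (horizontal ξ η Y), eX, bracket_swap X ξ, eξ, bracket_self,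
    bracket_swap (horizontal ξ η Y) ξ, bracket_swap (horizontal ξ η Y) (horizontal ξ η X)]
  simp only [map_add, map_smul, map_neg, h1, hξ _ hX, hξ _ hY, smul_eq_mul, map_zero,
    horizontal_apply, map_sub]
  ring

/-- A vector field whose flow preserves the CR structure is a contact field. -/
theorem isContactField_of_preservesJ (h1 : ∀ p, η p (ξ p) = 1) (hη : C.Represents η)
    {X : SmoothVF E M} (hX : C.PreservesJ X) : C.IsContactField X := by
  intro η' hη'
  have hne : ∀ p, η' p (ξ p) ≠ 0 := fun p h => by
    have := h1 p
    rw [hη.mem_iff.1 (hη'.mem_iff.2 h)] at this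
    exact zero_ne_one this
  have hs : IsSmoothFun E (fun p => OneForm.lieDeriv X η' ξ p) :=
    (isSmoothFun_mvfderiv (η'.smooth ξ) X).sub (η'.smooth (SmoothVF.lie X ξ))
  -- Bracketing with `X` preserves sections of `𝒟`, so `£_X η'` vanishes on `𝒟` and is a multiple of
  -- `η'`; evaluating at `ξ` gives the factor.
  refine ⟨fun p => OneForm.lieDeriv X η' ξ p / η' p (ξ p), hs.div₀ (η'.smooth ξ) hne,
    fun Y p => ?_⟩
  have hmul : (fun q => η' q (Y q)) = (fun q => η q (Y q)) * (fun q => η' q (ξ q)) :=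
    funext fun q => hη.eq_mul h1 hη' q (Y q)
  have hY := isSection_horizontal h1 hη Y
  have eY : bracket X Y p = bracket X (horizontal ξ η Y) p
      + (mvfderiv 𝓘(ℝ, E) (fun p => η p (Y p)) p (X p) • ξ p + η p (Y p) • bracket X ξ p) := by
    conv_lhs => rw [eq_horizontal_add (ξ := ξ) (η := η) Y]
    rw [bracket_add_right, bracket_fsmul_right]
  obtain ⟨hm, -⟩ := hX _ hY p
  rw [hη'.mem_iff] at hm
  unfold OneForm.lieDeriv
  rw [hmul, mvfderiv_mul ((η.smooth Y).mdifferentiableAt (by simp))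
    ((η'.smooth ξ).mdifferentiableAt (by simp)), eY, hη.eq_mul h1 hη' p (Y p)]
  simp only [map_add, map_smul, hm, smul_eq_mul]
  have := hne p
  field_simp
  simp
  ring

theorem isCRField_iff (h1 : ∀ p, η p (ξ p) = 1) (hη : C.Represents η)
    {X : SmoothVF E M} : C.IsCRField X ↔ C.PreservesJ X :=
  ⟨fun h => h.2, fun h => ⟨isContactField_of_preservesJ h1 hη h, h⟩⟩

end CRStructure

end Contact

/-! ### The Levi sign, uniqueness, and deformation of Sasakian structures -/

section Sasakian

theorem OneForm.ext {η η' : OneForm E M} (h : ∀ p v, η p v = η' p v) : η = η' := by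
  cases η
  cases η'
  congr
  exact funext fun p => LinearMap.ext (h p)

theorem EndoField.ext {Φ Φ' : EndoField E M} (h : ∀ p v, Φ p v = Φ' p v) : Φ = Φ' := by
  cases Φ
  cases Φ'
  congr
  exact funext fun p => LinearMap.ext (h p)

theorem Metric.ext {g g' : Metric E M} (h : ∀ p u v, g p u v = g' p u v) : g = g' := by
  cases g
  cases g'
  congr
  exact funext fun p => LinearMap.ext₂ (h p)

theorem SasakianStructure.ext {c : ℝ} {S S' : SasakianStructure c E M} (h1 : S.ξ = S'.ξ)
    (h2 : S.η = S'.η) (h3 : S.Φ = S'.Φ) (h4 : S.g = S'.g) : S = S' := by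
  cases S
  cases S'
  cases h1
  cases h2
  cases h3
  cases h4
  rfl

namespace CRStructure

variable {C : CRStructure E M} {c : ℝ} {S S' : SasakianStructure c E M}

theorem exists_isSection_ne_zero (hE : 2 ≤ Module.finrank ℝ E) (p : M) :
    ∃ Y : SmoothVF E M, C.IsSection Y ∧ Y p ≠ 0 := by
  have h1 := C.corank_one p
  have : Nontrivial (C.D p) := Module.nontrivial_of_finrank_pos (R := ℝ) (by omega)
  obtain ⟨v, hv⟩ := exists_ne (0 : C.D p)
  obtain ⟨Y, hY, hY'⟩ := C.smooth_D p v
  exact ⟨Y, hY, by rw [hY']; simpa using hv⟩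

/-- `dη(ξ, Y) = g(Φξ, Y) = 0`, and both derivative terms of `dη` vanish because `η(ξ)` and `η(Y)`
are constant. -/
theorem eta_bracket_reeb (hc : 0 < c) (hS : S ∈ C.sasakianStructures c) {Y : SmoothVF E M}
    (hY : C.IsSection Y) (p : M) : S.η p (bracket S.ξ Y p) = 0 := by
  have h := S.contact_metric S.ξ Y p
  rw [phi_xi_eq_zero S.eta_xi S.phi_sq, map_zero, LinearMap.zero_apply, OneForm.d,
    mvfderiv_eq_zero_of_const (fun q => hS.1.mem_iff.1 (hY q)),
    mvfderiv_eq_zero_of_const S.eta_xi, sub_zero, zero_sub] at h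
  have := (mul_eq_zero.1 h.symm).resolve_left hc.ne'
  exact neg_eq_zero.1 this

/-- The sign of the Levi form of a Sasakian structure. -/
theorem eta_bracket_applyJ_neg (hc : 0 < c) (hS : S ∈ C.sasakianStructures c) {Y : SmoothVF E M}
    (hY : C.IsSection Y) {p : M} (hp : Y p ≠ 0) :
    S.η p (bracket Y (C.applyJ Y hY) p) < 0 := by
  have hJY : C.IsSection (C.applyJ Y hY) := fun q => (C.J q ⟨Y q, hY q⟩).2
  -- This reads `g(ΦY, ΦY) = -c η([Y, JY])`, and the left side equals `g(Y, Y)` on `𝒟`.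
  have h := S.contact_metric Y (C.applyJ Y hY) p
  rw [d_of_isSection c hS.1 hY hJY] at h
  have h2 : C.applyJ Y hY p = S.Φ p (Y p) := (hS.2 p ⟨Y p, hY p⟩).symm
  rw [h2, S.compatible, hS.1.mem_iff.1 (hY p), mul_zero, sub_zero] at h
  have h3 := S.g.pos p _ hp
  rw [h] at h3
  exact neg_of_mul_neg_right (neg_pos.1 h3) hc.le

theorem preservesJ_reeb [CompleteSpace E] (hc : 0 < c) (hS : S ∈ C.sasakianStructures c) :
    C.PreservesJ S.ξ :=
  preservesJ_of_isNormal hS.1 hS.2 (fun _ hY => eta_bracket_reeb hc hS hY) S.normal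

/-- Both forms are negative on the same vector `[Y, JY]`, so their ratio `η'(ξ)` is positive. -/
theorem eta_reeb_pos (hE : 2 ≤ Module.finrank ℝ E) (hc : 0 < c)
    (hS : S ∈ C.sasakianStructures c) (hS' : S' ∈ C.sasakianStructures c) (p : M) :
    0 < S'.η p (S.ξ p) := by
  obtain ⟨Y, hY, hp⟩ := C.exists_isSection_ne_zero hE p
  have h := eta_bracket_applyJ_neg hc hS hY hp
  have h' := eta_bracket_applyJ_neg hc hS' hY hp
  rw [hS.1.eq_mul S.eta_xi hS'.1] at h'
  exact pos_of_mul_neg_right h' h.le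

/-- Sasakian forms differ by positive factors and the contact condition is automatic, so a single
structure decides membership. -/
theorem mem_crPos_iff [CompleteSpace E] (hE : 2 ≤ Module.finrank ℝ E) (hc : 0 < c)
    (hS : S ∈ C.sasakianStructures c) {X : SmoothVF E M} :
    X ∈ C.crPos c ↔ C.PreservesJ X ∧ ∀ p, 0 < S.η p (X p) := by
  refine ⟨fun h => ⟨h.1.2, h.2 S hS⟩, fun h => ⟨(isCRField_iff S.eta_xi hS.1).2 h.1, ?_⟩⟩
  intro S' hS' p
  rw [hS.1.eq_mul S.eta_xi hS'.1]
  exact mul_pos (h.2 p) (eta_reeb_pos hE hc hS hS' p)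

theorem reeb_mem_crPos [CompleteSpace E] (hE : 2 ≤ Module.finrank ℝ E) (hc : 0 < c)
    (hS : S ∈ C.sasakianStructures c) : S.ξ ∈ C.crPos c :=
  (mem_crPos_iff hE hc hS).2 ⟨preservesJ_reeb hc hS, fun p => by rw [S.eta_xi]; exact one_pos⟩

/-- The first term on the right is a value of `dη`, so `g` is recovered from `η` and `Φ`. -/
theorem metric_eq (S : SasakianStructure c E M) (p : M) (u v : TangentSpace 𝓘(ℝ, E) p) :
    S.g p u v = -S.g p (S.Φ p (S.Φ p u)) v + S.η p u * S.η p v := by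
  have h := S.compatible p (S.ξ p) v
  rw [phi_xi_eq_zero S.eta_xi S.phi_sq, map_zero, LinearMap.zero_apply, S.eta_xi, one_mul,
    eq_comm, sub_eq_zero] at h
  rw [S.phi_sq, map_add, map_neg, map_smul, LinearMap.add_apply, LinearMap.neg_apply,
    LinearMap.smul_apply, h, smul_eq_mul]
  ring

/-- A Sasakian structure is determined by its CR structure and its Reeb field. -/
theorem eq_of_reeb_eq (hS : S ∈ C.sasakianStructures c) (hS' : S' ∈ C.sasakianStructures c)
    (h : S.ξ = S'.ξ) : S = S' := by
  have hη : S.η = S'.η := OneForm.ext fun p v => by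
    rw [hS.1.eq_mul S.eta_xi hS'.1, h, S'.eta_xi, mul_one]
  have hΦ : S.Φ = S'.Φ := EndoField.ext fun p v => by
    have hv : v - S.η p v • S.ξ p ∈ C.D p := by
      rw [hS.1.mem_iff, map_sub, map_smul, S.eta_xi, smul_eq_mul, mul_one, sub_self]
    have h1 := (hS.2 p ⟨_, hv⟩).trans (hS'.2 p ⟨_, hv⟩).symm
    simp only [map_sub, map_smul, phi_xi_eq_zero S.eta_xi S.phi_sq] at h1
    rwa [h, phi_xi_eq_zero S'.eta_xi S'.phi_sq, smul_zero, sub_zero, sub_zero] at h1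
  refine SasakianStructure.ext h hη hΦ (Metric.ext fun p u v => ?_)
  -- `dη` is defined on smooth fields only, so the vectors `Φu` and `v` are extended before
  -- comparing the metrics.
  obtain ⟨W, hW⟩ := exists_smoothVF_eq S.eta_xi hS.1 p (S.Φ p u)
  obtain ⟨V, hV⟩ := exists_smoothVF_eq S.eta_xi hS.1 p v
  have h1 := (S.contact_metric W V p).trans ((hη ▸ S'.contact_metric W V p).symm)
  rw [metric_eq S, metric_eq S', ← hΦ, ← hη, ← hW, ← hV, h1, hΦ]

/-- The Sasakian structure with the same CR structure and Reeb field `ξ`. -/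
def deform [FiniteDimensional ℝ E] [CompleteSpace E] [T2Space M] (S : SasakianStructure c E M)
    (hS : S ∈ C.sasakianStructures c) (ξ : SmoothVF E M) (hξ : C.PreservesJ ξ)
    (hpos : ∀ p, 0 < S.η p (ξ p)) : SasakianStructure c E M :=
  have hf : IsSmoothFun E (fun p => (S.η p (ξ p))⁻¹) :=
    (S.η.smooth ξ).inv₀ fun p => (hpos p).ne'
  let η : OneForm E M :=
    { toFun := fun p => (S.η p (ξ p))⁻¹ • S.η p
      smooth := fun X => hf.mul (S.η.smooth X) }
  let pr : ∀ p : M, TangentSpace 𝓘(ℝ, E) p →ₗ[ℝ] TangentSpace 𝓘(ℝ, E) p :=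
    fun p => LinearMap.id - (η p).smulRight (ξ p)
  let Φ : EndoField E M :=
    { toFun := fun p => S.Φ p ∘ₗ pr p
      smooth := fun X => S.Φ.smooth (horizontal ξ η X) }
  have hη : ∀ p v, η p v = (S.η p (ξ p))⁻¹ * S.η p v := fun p v => rfl
  have hpr : ∀ p v, pr p v = v - η p v • ξ p := fun p v => rfl
  have h1 : ∀ p, η p (ξ p) = 1 := fun p => inv_mul_cancel₀ (hpos p).ne'
  have hrep : C.Represents η := fun p => by
    ext v
    rw [LinearMap.mem_ker, hS.1.mem_iff, hη, mul_eq_zero, or_iff_right (inv_ne_zero (hpos p).ne')]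
  have hprη : ∀ p v, S.η p (pr p v) = 0 := fun p v => by
    rw [← hS.1.mem_iff, hrep.mem_iff, hpr, map_sub, map_smul, h1, smul_eq_mul, mul_one, sub_self]
  have hpr_of : ∀ p v, S.η p v = 0 → pr p v = v := fun p v hv => by
    rw [hpr, hη, hv, mul_zero, zero_smul, sub_zero]
  have hΦ : ∀ p v, Φ p v = S.Φ p (pr p v) := fun p v => rfl
  have hηΦ : ∀ p v, S.η p (Φ p v) = 0 := fun p v => eta_phi_eq_zero S.eta_xi S.phi_sq p _
  have h2 : ∀ p v, Φ p (Φ p v) = -v + η p v • ξ p := fun p v => by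
    rw [hΦ p (Φ p v), hpr_of _ _ (hηΦ p v), hΦ, S.phi_sq, hprη, zero_smul, add_zero, hpr, neg_sub]
    abel
  have hJ : ∀ (p : M) (v : C.D p), Φ p v = C.J p v := fun p v => by
    rw [hΦ, hpr_of p v (hS.1.mem_iff.1 v.2), hS.2]
  let g : Metric E M :=
    { toFun := fun p => (S.η p (ξ p))⁻¹ • (S.g p).compl₁₂ (pr p) (pr p) + (η p).smulRight (η p)
      symm := fun p u v => by
        simp [LinearMap.compl₁₂_apply, S.g.symm p (pr p u), mul_comm]
      pos := fun p v hv => by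
        change 0 < (S.η p (ξ p))⁻¹ * S.g p (pr p v) (pr p v) + η p v * η p v
        have hi := inv_pos.2 (hpos p)
        by_cases h : pr p v = 0
        · have h' : η p v ≠ 0 := fun h0 => by
            rw [hpr, h0, zero_smul, sub_zero] at h
            exact hv h
          rw [h, map_zero, mul_zero, zero_add]
          exact mul_self_pos.2 h'
        · exact add_pos_of_pos_of_nonneg (mul_pos hi (S.g.pos p _ h)) (mul_self_nonneg _)
      smooth := fun X Y => ((hf.mul (S.g.smooth (horizontal ξ η X) (horizontal ξ η Y))).add
        ((η.smooth X).mul (η.smooth Y))).congr fun p => rfl }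
  have hg : ∀ p u v, g p u v = (S.η p (ξ p))⁻¹ * S.g p (pr p u) (pr p v) + η p u * η p v :=
    fun p u v => rfl
  { ξ := ξ
    η := η
    Φ := Φ
    g := g
    eta_xi := h1
    phi_sq := h2
    compatible := fun p u v => by
      rw [hg, hg, eta_phi_eq_zero h1 h2, hpr_of _ _ (hηΦ p u), hpr_of _ _ (hηΦ p v), hΦ, hΦ,
        S.compatible, hprη]
      ring
    -- Both sides depend only on horizontal parts, since `Φξ = 0` and `dη(ξ, ·) = 0`. There `dη` is
    -- a multiple of `η([·, ·])`, so the identity for `S` is scaled by `1/η₀(ξ)`.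
    contact_metric := fun X Y p => by
      have hX := isSection_horizontal h1 hrep X
      have hY := isSection_horizontal h1 hrep Y
      have hb : ∀ Z : SmoothVF E M, C.IsSection Z → ∀ p, η p (bracket ξ Z p) = 0 :=
        fun Z hZ p => hrep.mem_iff.1 (hξ Z hZ p).1
      have h3 := S.contact_metric (horizontal ξ η X) (horizontal ξ η Y) p
      rw [d_of_isSection c hS.1 hX hY] at h3
      rw [d_eq_horizontal c h1 hrep hb, hg, eta_phi_eq_zero h1 h2, zero_mul, add_zero,
        hpr_of _ _ (hηΦ p _), hΦ, hη]
      refine (congrArg ((S.η p (ξ p))⁻¹ * ·) h3).trans ?_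
      ring
    normal := isNormal_of_preservesJ h1 h2 hrep hJ hξ }

theorem deform_mem [FiniteDimensional ℝ E] [CompleteSpace E] [T2Space M]
    (hS : S ∈ C.sasakianStructures c) {ξ : SmoothVF E M} (hξ : C.PreservesJ ξ)
    (hpos : ∀ p, 0 < S.η p (ξ p)) : deform S hS ξ hξ hpos ∈ C.sasakianStructures c := by
  refine ⟨fun p => ?_, fun p v => ?_⟩
  · ext v
    change (S.η p (ξ p))⁻¹ * S.η p v = 0 ↔ _
    rw [hS.1.mem_iff, mul_eq_zero, or_iff_right (inv_ne_zero (hpos p).ne')]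
  · change S.Φ p (v - ((S.η p (ξ p))⁻¹ * S.η p v) • ξ p) = _
    rw [hS.1.mem_iff.1 v.2, mul_zero, zero_smul, sub_zero, hS.2]

end CRStructure

end Sasakian

/-! ### Push-forward by CR automorphisms -/

section Automorphisms

section Pushforward

variable (φ : M ≃ₘ^∞⟮𝓘(ℝ, E), 𝓘(ℝ, E)⟯ M)

/-- The differential of `φ` as a map into the tangent space at `q`. -/
def pushVec (q : M) : TangentSpace 𝓘(ℝ, E) (φ.symm q) →ₗ[ℝ] TangentSpace 𝓘(ℝ, E) q :=
  ContinuousLinearMap.toLinearMap (M := E) (M₂ := E) (mfderiv 𝓘(ℝ, E) 𝓘(ℝ, E) φ (φ.symm q))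

theorem pushforward_apply (X : SmoothVF E M) (q : M) :
    pushforward φ X q = pushVec φ q (X (φ.symm q)) := rfl

theorem mfderiv_comp_mfderiv_symm (q : M) :
    (mfderiv 𝓘(ℝ, E) 𝓘(ℝ, E) φ (φ.symm q) : E →L[ℝ] E).comp
      (mfderiv 𝓘(ℝ, E) 𝓘(ℝ, E) φ.symm q : E →L[ℝ] E) = ContinuousLinearMap.id ℝ E := by
  have h := mfderiv_comp q (φ.mdifferentiable (by simp) (φ.symm q))
    (φ.symm.mdifferentiable (by simp) q)
  have h2 : (φ ∘ φ.symm : M → M) = id := funext φ.apply_symm_apply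
  rw [h2, mfderiv_id] at h
  exact h.symm

theorem mfderiv_symm_comp_mfderiv (p : M) :
    (mfderiv 𝓘(ℝ, E) 𝓘(ℝ, E) φ.symm (φ p) : E →L[ℝ] E).comp
      (mfderiv 𝓘(ℝ, E) 𝓘(ℝ, E) φ p : E →L[ℝ] E) = ContinuousLinearMap.id ℝ E :=
  mfderiv_comp_mfderiv_symm φ.symm p

theorem pushVec_injective (q : M) : Function.Injective (pushVec φ q) := by
  -- The points `φ (φ.symm q)` and `q` are equal only propositionally; a free `q` with `φ p = q` can
  -- be substituted away.
  have h : ∀ (p q : M) (_ : φ p = q), Function.Injective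
      (mfderiv 𝓘(ℝ, E) 𝓘(ℝ, E) φ p : E → E) := by
    rintro p _ rfl u v huv
    have h3 := fun w => congrArg (fun T : E →L[ℝ] E => T w) (mfderiv_symm_comp_mfderiv φ p)
    have h4 := congrArg (mfderiv 𝓘(ℝ, E) 𝓘(ℝ, E) φ.symm (φ p) : E → E) huv
    exact ((h3 u).symm.trans h4).trans (h3 v)
  exact h (φ.symm q) q (φ.apply_symm_apply q)

theorem pushforward_pushforward_symm (X : SmoothVF E M) :
    pushforward φ (pushforward φ.symm X) = X := by
  ext q
  have h : ∀ q' : M, q' = q → (mfderiv 𝓘(ℝ, E) 𝓘(ℝ, E) φ (φ.symm q) : E →L[ℝ] E)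
      ((mfderiv 𝓘(ℝ, E) 𝓘(ℝ, E) φ.symm q' : E →L[ℝ] E) (X q')) = X q := by
    rintro _ rfl
    exact congrArg (fun T : E →L[ℝ] E => T (X _)) (mfderiv_comp_mfderiv_symm φ _)
  exact h (φ (φ.symm q)) (φ.apply_symm_apply q)

/-- This turns naturality of the bracket under pullback into naturality under push-forward. -/
theorem mpullback_symm_eq_pushforward (X : SmoothVF E M) :
    VectorField.mpullback 𝓘(ℝ, E) 𝓘(ℝ, E) φ.symm X = pushforward φ X := by
  funext q
  have h2 : (mfderiv 𝓘(ℝ, E) 𝓘(ℝ, E) φ.symm q : E →L[ℝ] E).comp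
      (mfderiv 𝓘(ℝ, E) 𝓘(ℝ, E) φ (φ.symm q) : E →L[ℝ] E) = ContinuousLinearMap.id ℝ E := by
    have := mfderiv_symm_comp_mfderiv φ (φ.symm q)
    rwa [φ.apply_symm_apply] at this
  have hinv : (mfderiv 𝓘(ℝ, E) 𝓘(ℝ, E) φ.symm q : E →L[ℝ] E).IsInvertible :=
    ContinuousLinearMap.IsInvertible.of_inverse h2 (mfderiv_comp_mfderiv_symm φ q)
  exact inverse_apply_of_comp_eq_id hinv h2 _

theorem bracket_pushforward [CompleteSpace E] (X Y : SmoothVF E M) :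
    SmoothVF.lie (pushforward φ X) (pushforward φ Y) = pushforward φ (SmoothVF.lie X Y) := by
  ext q
  have : IsManifold 𝓘(ℝ, E) (minSmoothness ℝ 3) M :=
    IsManifold.of_le (n := ∞) (by
      rw [minSmoothness_of_isRCLikeNormedField]
      exact WithTop.coe_le_coe.2 (le_top : (3 : ℕ∞) ≤ ⊤))
  have : IsManifold 𝓘(ℝ, E) (minSmoothness ℝ 2) M :=
    IsManifold.of_le (n := ∞) (by
      rw [minSmoothness_of_isRCLikeNormedField]
      exact WithTop.coe_le_coe.2 (le_top : (2 : ℕ∞) ≤ ⊤))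
  have h := VectorField.mpullback_mlieBracket (I := 𝓘(ℝ, E)) (I' := 𝓘(ℝ, E)) (f := φ.symm)
    (n := ∞) (x₀ := q) (X.mdifferentiableAt (φ.symm q)) (Y.mdifferentiableAt (φ.symm q))
    φ.symm.contMDiff.contMDiffAt (by
      rw [minSmoothness_of_isRCLikeNormedField]
      exact WithTop.coe_le_coe.2 (le_top : (2 : ℕ∞) ≤ ⊤))
  rw [mpullback_symm_eq_pushforward, mpullback_symm_eq_pushforward] at h
  exact h.symm.trans (congrFun (mpullback_symm_eq_pushforward φ (SmoothVF.lie X Y)) q)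

end Pushforward

namespace CRStructure

variable {C : CRStructure E M} {c : ℝ} {S : SasakianStructure c E M}

theorem preservesJ_iff (hS : S ∈ C.sasakianStructures c) {X : SmoothVF E M} :
    C.PreservesJ X ↔ ∀ Y : SmoothVF E M, C.IsSection Y → ∀ p, bracket X Y p ∈ C.D p ∧
      bracket X (S.Φ.apply Y) p = S.Φ p (bracket X Y p) := by
  refine ⟨fun h Y hY p => ?_, fun h Y hY p => ⟨(h Y hY p).1, ?_⟩⟩
  · obtain ⟨h1, h2⟩ := h Y hY p
    rw [applyJ_eq_apply hS.2, coe_J_apply_eq hS.2] at h2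
    exact ⟨h1, h2⟩
  · rw [applyJ_eq_apply hS.2, coe_J_apply_eq hS.2, (h Y hY p).2]

/-- A diffeomorphism whose differential preserves `ker η` and commutes with `Φ` there. -/
structure IsCRMap (S : SasakianStructure c E M) (φ : M ≃ₘ^∞⟮𝓘(ℝ, E), 𝓘(ℝ, E)⟯ M) : Prop where
  exists_eta : ∀ q, ∃ a : ℝ, ∀ v, S.η q (pushVec φ q v) = a * S.η (φ.symm q) v
  phi : ∀ q v, S.η (φ.symm q) v = 0 →
    pushVec φ q (S.Φ (φ.symm q) v) = S.Φ q (pushVec φ q v)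

variable {φ : M ≃ₘ^∞⟮𝓘(ℝ, E), 𝓘(ℝ, E)⟯ M}

theorem isCRMap_of_mem_CRAut (hS : S ∈ C.sasakianStructures c) (hφ : φ ∈ C.CRAut) :
    IsCRMap S φ := by
  obtain ⟨f, -, -, hf⟩ := hφ.1 S.η hS.1
  refine ⟨fun q => ⟨f (φ.symm q), fun v => ?_⟩, fun q v hv => ?_⟩
  · have h : ∀ (p q : M) (_ : φ p = q) (v : E),
        S.η q (mfderiv 𝓘(ℝ, E) 𝓘(ℝ, E) φ p v : E) = f p * S.η p v := by
      rintro p _ rfl v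
      exact hf p v
    exact h (φ.symm q) q (φ.apply_symm_apply q) v
  · have h : ∀ (p q : M) (_ : φ p = q) (v : TangentSpace 𝓘(ℝ, E) p) (_ : S.η p v = 0),
        (mfderiv 𝓘(ℝ, E) 𝓘(ℝ, E) φ p (S.Φ p v) : E) =
          S.Φ q (mfderiv 𝓘(ℝ, E) 𝓘(ℝ, E) φ p v : E) := by
      rintro p _ rfl v hv
      have hm := hS.1.mem_iff.2 hv
      obtain ⟨h1, h2⟩ := hφ.2 p ⟨v, hm⟩
      rw [coe_J_apply_eq hS.2, coe_J_apply_eq hS.2] at h2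
      exact h2
    exact h (φ.symm q) q (φ.apply_symm_apply q) v hv

/-- The conditions on `dφ` are inverted pointwise; since `f` vanishes nowhere, the inverse scales
`η` by `f⁻¹` and so also preserves `𝒟`. -/
theorem isCRMap_symm_of_mem_CRAut (hS : S ∈ C.sasakianStructures c) (hφ : φ ∈ C.CRAut) :
    IsCRMap S φ.symm := by
  obtain ⟨f, -, hf0, hf⟩ := hφ.1 S.η hS.1
  have hinv : ∀ (p : M) (w : E), (mfderiv 𝓘(ℝ, E) 𝓘(ℝ, E) φ p : E →L[ℝ] E)
      ((mfderiv 𝓘(ℝ, E) 𝓘(ℝ, E) φ.symm (φ p) : E →L[ℝ] E) w) = w := by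
    intro p w
    have := congrArg (fun T : E →L[ℝ] E => T w) (mfderiv_comp_mfderiv_symm φ (φ p))
    rwa [φ.symm_apply_apply] at this
  have hη : ∀ (p : M) (w : TangentSpace 𝓘(ℝ, E) (φ p)),
      S.η p (pushVec φ.symm p w) = (f p)⁻¹ * S.η (φ p) w := by
    intro p w
    have h1 := hf p (pushVec φ.symm p w)
    have h2 : mfderiv 𝓘(ℝ, E) 𝓘(ℝ, E) φ p (pushVec φ.symm p w) = w := hinv p w
    rw [h2] at h1
    rw [h1, inv_mul_cancel_left₀ (hf0 p)]
  refine ⟨fun p => ⟨(f p)⁻¹, hη p⟩, fun p w hw => ?_⟩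
  have h0 : S.η p (pushVec φ.symm p w) = 0 :=
    (hη p w).trans (mul_eq_zero_of_right _ hw)
  have hm := hS.1.mem_iff.2 h0
  obtain ⟨h1, h2⟩ := hφ.2 p ⟨_, hm⟩
  rw [coe_J_apply_eq hS.2, coe_J_apply_eq hS.2] at h2
  have h3 : mfderiv 𝓘(ℝ, E) 𝓘(ℝ, E) φ p (pushVec φ.symm p w) = w := hinv p w
  rw [h3] at h2
  have h4 := congrArg (fun u : E => (mfderiv 𝓘(ℝ, E) 𝓘(ℝ, E) φ.symm (φ p) : E →L[ℝ] E) u) h2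
  exact h4.symm.trans (congrArg (fun T : E →L[ℝ] E => T (S.Φ p (pushVec φ.symm p w)))
    (mfderiv_symm_comp_mfderiv φ p))

theorem IsCRMap.isSection_pushforward (hS : S ∈ C.sasakianStructures c) (hφ : IsCRMap S φ)
    {X : SmoothVF E M} (hX : C.IsSection X) : C.IsSection (pushforward φ X) := by
  intro q
  obtain ⟨a, ha⟩ := hφ.exists_eta q
  rw [hS.1.mem_iff, pushforward_apply, ha, hS.1.mem_iff.1 (hX _), mul_zero]

theorem IsCRMap.apply_pushforward (hS : S ∈ C.sasakianStructures c) (hφ : IsCRMap S φ)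
    {X : SmoothVF E M} (hX : C.IsSection X) :
    S.Φ.apply (pushforward φ X) = pushforward φ (S.Φ.apply X) := by
  ext q
  exact (hφ.phi q _ (hS.1.mem_iff.1 (hX _))).symm

variable [CompleteSpace E]

theorem IsCRMap.preservesJ_pushforward (hS : S ∈ C.sasakianStructures c) (hφ : IsCRMap S φ)
    (hφ' : IsCRMap S φ.symm) {X : SmoothVF E M} (hX : C.PreservesJ X) :
    C.PreservesJ (pushforward φ X) := by
  rw [preservesJ_iff hS] at hX ⊢
  intro Y hY q
  obtain ⟨Z, hZ, rfl⟩ : ∃ Z, C.IsSection Z ∧ pushforward φ Z = Y :=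
    ⟨_, hφ'.isSection_pushforward hS hY, pushforward_pushforward_symm φ Y⟩
  have hb : ∀ W : SmoothVF E M, bracket (pushforward φ X) (pushforward φ W) q =
      pushVec φ q (bracket X W (φ.symm q)) := fun W =>
    congrArg (fun V : SmoothVF E M => V q) (bracket_pushforward φ X W)
  obtain ⟨h1, h2⟩ := hX Z hZ (φ.symm q)
  obtain ⟨a, ha⟩ := hφ.exists_eta q
  rw [hφ.apply_pushforward hS hZ, hb, hb, h2, hφ.phi q _ (hS.1.mem_iff.1 h1), hS.1.mem_iff, ha,
    hS.1.mem_iff.1 h1, mul_zero]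
  exact ⟨rfl, rfl⟩

/-- The Levi sign holds for `Y` and for `φ_*Y`, while `φ_*` carries `[Y, JY]` to `[φ_*Y, Jφ_*Y]`;
hence the conformal factor `a` is positive. -/
theorem IsCRMap.eta_pushforward_pos (hE : 2 ≤ Module.finrank ℝ E) (hc : 0 < c)
    (hS : S ∈ C.sasakianStructures c) (hφ : IsCRMap S φ) {X : SmoothVF E M}
    (hX : ∀ p, 0 < S.η p (X p)) (q : M) : 0 < S.η q (pushforward φ X q) := by
  obtain ⟨a, ha⟩ := hφ.exists_eta q
  obtain ⟨Y, hY, hY0⟩ := C.exists_isSection_ne_zero hE (φ.symm q)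
  have hY' := hφ.isSection_pushforward hS hY
  have hq : pushforward φ Y q ≠ 0 := fun h =>
    hY0 (pushVec_injective φ q (h.trans (map_zero (pushVec φ q)).symm))
  have h1 := eta_bracket_applyJ_neg hc hS hY hY0
  have h2 := eta_bracket_applyJ_neg hc hS hY' hq
  have hb : bracket (pushforward φ Y) (pushforward φ (S.Φ.apply Y)) q =
      pushVec φ q (bracket Y (S.Φ.apply Y) (φ.symm q)) :=
    congrArg (fun V : SmoothVF E M => V q) (bracket_pushforward φ Y (S.Φ.apply Y))
  rw [applyJ_eq_apply hS.2] at h1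
  rw [applyJ_eq_apply hS.2, hφ.apply_pushforward hS hY, hb, ha] at h2
  rw [pushforward_apply, ha]
  exact mul_pos (pos_of_mul_neg_left h2 h1.le) (hX _)

theorem IsCRMap.pushforward_mem_crPos (hE : 2 ≤ Module.finrank ℝ E) (hc : 0 < c)
    (hS : S ∈ C.sasakianStructures c) (hφ : IsCRMap S φ) (hφ' : IsCRMap S φ.symm)
    {X : SmoothVF E M} (hX : X ∈ C.crPos c) : pushforward φ X ∈ C.crPos c := by
  rw [mem_crPos_iff hE hc hS] at hX ⊢
  exact ⟨hφ.preservesJ_pushforward hS hφ' hX.1, hφ.eta_pushforward_pos hE hc hS hX.2⟩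

theorem pushforward_image_crPos (hE : 2 ≤ Module.finrank ℝ E) (hc : 0 < c)
    (hS : S ∈ C.sasakianStructures c) (hφ : φ ∈ C.CRAut) :
    pushforward φ '' C.crPos c = C.crPos c := by
  have h1 := isCRMap_of_mem_CRAut hS hφ
  have h2 := isCRMap_symm_of_mem_CRAut hS hφ
  refine Set.Subset.antisymm (Set.image_subset_iff.2 fun X hX =>
    h1.pushforward_mem_crPos hE hc hS h2 hX) fun X hX => ?_
  exact ⟨pushforward φ.symm X, h2.pushforward_mem_crPos hE hc hS h1 hX,
    pushforward_pushforward_symm φ X⟩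

end CRStructure

end Automorphisms

/-! ### Openness, convexity and the Reeb bijection -/

section PositiveCone

section Openness

variable [FiniteDimensional ℝ E] [T2Space M]

/-- A smooth `1`-form is locally bounded with respect to the preferred trivialization. -/
theorem OneForm.exists_eventually_abs_le (η : OneForm E M) (p : M) :
    ∃ K : ℝ, 0 < K ∧ ∀ᶠ q in 𝓝 p, ∀ v : TangentSpace 𝓘(ℝ, E) q, |η q v| ≤
      K * ‖(trivializationAt E (fun p : M => TangentSpace 𝓘(ℝ, E) p) p ⟨q, v⟩).2‖ := by
  obtain ⟨e, he⟩ := exists_smoothVF_frame (E := E) p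
  let b := Module.finBasis ℝ E
  let A : Fin (Module.finrank ℝ E) → ℝ := fun i => ‖(b.coord i).toContinuousLinearMap‖
  let B : Fin (Module.finrank ℝ E) → ℝ := fun i => |η p (e i p)| + 1
  have hB : ∀ i, ∀ᶠ q in 𝓝 p, |η q (e i q)| < B i := fun i =>
    ((η.smooth (e i)).continuous.abs.continuousAt.eventually_lt continuousAt_const (lt_add_one _))
  -- The summand `1` makes the bound strictly positive, so that it can be divided by later.
  refine ⟨∑ i, A i * B i + 1, ?_, ?_⟩
  · have : 0 ≤ ∑ i, A i * B i :=
      Finset.sum_nonneg fun i _ => mul_nonneg (norm_nonneg _) (by positivity)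
    linarith
  · filter_upwards [he, Filter.eventually_all.2 hB] with q hq hqB v
    set w := (trivializationAt E (fun p : M => TangentSpace 𝓘(ℝ, E) p) p ⟨q, v⟩).2
    have h1 : η q v = ∑ i, b.repr w i * η q (e i q) := by
      conv_lhs => rw [hq v]
      simp only [map_sum, map_smul, smul_eq_mul]
      rfl
    have h2 : ∀ i, |b.repr w i| ≤ A i * ‖w‖ := fun i =>
      (b.coord i).toContinuousLinearMap.le_opNorm w
    calc |η q v| ≤ ∑ i, |b.repr w i * η q (e i q)| := by
          rw [h1]
          exact Finset.abs_sum_le_sum_abs _ _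
      _ ≤ ∑ i, A i * ‖w‖ * B i := by
          refine Finset.sum_le_sum fun i _ => ?_
          rw [abs_mul]
          exact mul_le_mul (h2 i) (hqB i).le (abs_nonneg _)
            (mul_nonneg (norm_nonneg _) (norm_nonneg _))
      _ = (∑ i, A i * B i) * ‖w‖ := by
          rw [Finset.sum_mul]
          exact Finset.sum_congr rfl fun i _ => by ring
      _ ≤ (∑ i, A i * B i + 1) * ‖w‖ := by
          gcongr
          linarith

/-- Convergence in the `C^∞` topology implies uniform convergence on compact sets in charts. -/
theorem SmoothVF.tendstoUniformlyOn_localRep (X : SmoothVF E M) (p : M) {K : Set E}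
    (hK : IsCompact K) (hKt : K ⊆ (extChartAt 𝓘(ℝ, E) p).target) :
    TendstoUniformlyOn (fun Y : SmoothVF E M => Y.localRep p) (X.localRep p) (𝓝 X) K := by
  have h1 : Continuous (fun X : SmoothVF E M =>
      UniformOnFun.ofFun {K : Set E | IsCompact K ∧ K ⊆ (extChartAt 𝓘(ℝ, E) p).target}
        (iteratedFDeriv ℝ 0 (X.localRep p))) :=
    continuous_iInf_dom (i := p) (continuous_iInf_dom (i := 0) continuous_induced_dom)
  have h2 := UniformOnFun.tendsto_iff_tendstoUniformlyOn.1 (h1.tendsto X) K ⟨hK, hKt⟩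
  rw [Metric.tendstoUniformlyOn_iff] at h2 ⊢
  intro ε hε
  filter_upwards [h2 ε hε] with Y hY y hy
  refine lt_of_le_of_lt ?_ (hY y hy)
  -- Only the order-zero part of the topology is used; evaluating a `0`-multilinear map at its only
  -- argument is bounded by its norm.
  have h3 := (iteratedFDeriv ℝ 0 (X.localRep p) y - iteratedFDeriv ℝ 0 (Y.localRep p) y).le_opNorm 0
  rw [dist_eq_norm, dist_eq_norm]
  change _ ≤ ‖iteratedFDeriv ℝ 0 (X.localRep p) y - iteratedFDeriv ℝ 0 (Y.localRep p) y‖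
  simpa using h3

/-- On a small compact neighbourhood `η(X)` exceeds half its value at `p`, and `|η(X - Y)|` is less
than that half once `Y` is uniformly close to `X` there. -/
theorem eventually_eta_pos_near (η : OneForm E M) [LocallyCompactSpace M] (X : SmoothVF E M) (p : M)
    (hX : 0 < η p (X p)) :
    ∃ s ∈ 𝓝 p, ∀ᶠ Y : SmoothVF E M in 𝓝 X, ∀ q ∈ s, 0 < η q (Y q) := by
  let t := trivializationAt E (fun p : M => TangentSpace 𝓘(ℝ, E) p) p
  have hp : p ∈ t.baseSet := FiberBundle.mem_baseSet_trivializationAt' p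
  obtain ⟨K, hK, hb⟩ := η.exists_eventually_abs_le p
  have hlt : ∀ᶠ q in 𝓝 p, η p (X p) / 2 < η q (X q) :=
    continuousAt_const.eventually_lt (η.smooth X).continuous.continuousAt (half_lt_self hX)
  have hsrc : ∀ᶠ q in 𝓝 p, q ∈ (extChartAt 𝓘(ℝ, E) p).source := extChartAt_source_mem_nhds p
  have hbase : ∀ᶠ q in 𝓝 p, q ∈ t.baseSet := t.open_baseSet.mem_nhds hp
  obtain ⟨s, hs, hss, hsc⟩ := local_compact_nhds ((hb.and hlt).and (hsrc.and hbase))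
  refine ⟨s, hs, ?_⟩
  have hc : IsCompact (extChartAt 𝓘(ℝ, E) p '' s) :=
    hsc.image_of_continuousOn ((continuousOn_extChartAt p).mono fun q hq => (hss hq).2.1)
  have ht : extChartAt 𝓘(ℝ, E) p '' s ⊆ (extChartAt 𝓘(ℝ, E) p).target := by
    rintro _ ⟨q, hq, rfl⟩
    exact (extChartAt 𝓘(ℝ, E) p).map_source (hss hq).2.1
  have hu := Metric.tendstoUniformlyOn_iff.1 (X.tendstoUniformlyOn_localRep p hc ht)
    (η p (X p) / 2 / K) (by positivity)
  filter_upwards [hu] with Y hY q hq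
  obtain ⟨⟨hbq, hltq⟩, hsq, htq⟩ := hss hq
  have h1 := hY _ ⟨q, hq, rfl⟩
  have hrep : ∀ Z : SmoothVF E M, Z.localRep p (extChartAt 𝓘(ℝ, E) p q) =
      t.linearEquivAt ℝ q htq (Z q) := by
    intro Z
    unfold SmoothVF.localRep
    rw [(extChartAt 𝓘(ℝ, E) p).left_inv hsq]
    rfl
  rw [hrep, hrep, dist_eq_norm, ← map_sub, lt_div_iff₀ hK, mul_comm] at h1
  have h2 := (hbq (X q - Y q)).trans_lt h1
  rw [map_sub] at h2
  have h3 := (abs_lt.1 h2).2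
  linarith

theorem isOpen_setOf_eta_pos [CompactSpace M] (η : OneForm E M) :
    IsOpen {X : SmoothVF E M | ∀ p, 0 < η p (X p)} := by
  rw [isOpen_iff_mem_nhds]
  intro X hX
  choose s hs hs' using fun p => eventually_eta_pos_near η X p (hX p)
  obtain ⟨F, -, hF⟩ := isCompact_univ.elim_nhds_subcover s fun p _ => hs p
  filter_upwards [(Filter.eventually_all_finset F).2 fun p _ => hs' p] with Y hY q
  obtain ⟨p, hp, hq⟩ := Set.mem_iUnion₂.1 (hF (Set.mem_univ q))
  exact hY p hp q hq

end Openness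

namespace CRStructure

variable {C : CRStructure E M} {c : ℝ} {S : SasakianStructure c E M} [CompleteSpace E]

theorem isOpen_crPos [FiniteDimensional ℝ E] [T2Space M] [CompactSpace M]
    (hE : 2 ≤ Module.finrank ℝ E) (hc : 0 < c) (hS : S ∈ C.sasakianStructures c) :
    IsOpen {X : C.cr | X.1 ∈ C.crPos c} := by
  have h : {X : C.cr | X.1 ∈ C.crPos c} =
      Subtype.val ⁻¹' {X : SmoothVF E M | ∀ p, 0 < S.η p (X p)} := by
    ext X
    exact (mem_crPos_iff hE hc hS).trans (and_iff_right X.2.2)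
  rw [h]
  exact (isOpen_setOf_eta_pos S.η).preimage continuous_subtype_val

theorem smul_mem_crPos {a : ℝ} (ha : 0 < a) {X : SmoothVF E M} (hX : X ∈ C.crPos c) :
    a • X ∈ C.crPos c := by
  refine ⟨C.cr.smul_mem a hX.1, fun S hS p => ?_⟩
  change 0 < S.η p (a • X p)
  rw [map_smul]
  exact mul_pos ha (hX.2 S hS p)

theorem add_mem_crPos {X Y : SmoothVF E M} (hX : X ∈ C.crPos c) (hY : Y ∈ C.crPos c) :
    X + Y ∈ C.crPos c := by
  refine ⟨C.cr.add_mem hX.1 hY.1, fun S hS p => ?_⟩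
  change 0 < S.η p (X p + Y p)
  rw [map_add]
  exact add_pos (hX.2 S hS p) (hY.2 S hS p)

theorem convex_crPos : Convex ℝ {X : C.cr | X.1 ∈ C.crPos c} := by
  -- Zero weights must be excluded, since scaling by `0` leaves the cone.
  rw [convex_iff_forall_pos]
  intro X hX Y hY a b ha hb _
  exact add_mem_crPos (smul_mem_crPos ha hX) (smul_mem_crPos hb hY)

/-- The bijection between Sasakian structures and positive CR fields given by the Reeb field. -/
def reebEquiv [FiniteDimensional ℝ E] [T2Space M] (hE : 2 ≤ Module.finrank ℝ E) (hc : 0 < c)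
    (hC : C.IsSasakiType c) : C.sasakianStructures c ≃ C.crPos c :=
  Equiv.ofBijective (fun S => ⟨S.1.ξ, reeb_mem_crPos hE hc S.2⟩)
    ⟨fun S S' h => Subtype.ext (eq_of_reeb_eq S.2 S'.2 (congrArg Subtype.val h)), fun ξ => by
      obtain ⟨S, hS⟩ := hC
      exact ⟨⟨_, deform_mem hS ξ.2.1.2 (ξ.2.2 S hS)⟩, rfl⟩⟩

/-- Proportionality of forms with kernel `𝒟` gives the formula for any base structure `S`, not only
the one deformed to prove surjectivity. -/
theorem reebEquiv_symm_eta [FiniteDimensional ℝ E] [T2Space M] (hE : 2 ≤ Module.finrank ℝ E)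
    (hc : 0 < c) (hC : C.IsSasakiType c) (S : C.sasakianStructures c) (ξ : C.crPos c) (p : M)
    (v : TangentSpace 𝓘(ℝ, E) p) :
    ((reebEquiv hE hc hC).symm ξ).1.η p v = S.1.η p v / S.1.η p (ξ.1 p) := by
  obtain ⟨S', rfl⟩ := (reebEquiv hE hc hC).surjective ξ
  rw [Equiv.symm_apply_apply, S'.2.1.eq_mul S'.1.eta_xi S.2.1 p v]
  exact (mul_div_cancel_right₀ _ (eta_reeb_pos hE hc S'.2 S.2 p).ne').symm

end CRStructure

end PositiveCone

end SasakiCR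

end

theorem lemma6p3 (n : ℕ) (hn : 1 ≤ n) (M : Type*) [TopologicalSpace M]
    [ChartedSpace (EuclideanSpace ℝ (Fin (2 * n + 1))) M]
    [IsManifold 𝓘(ℝ, EuclideanSpace ℝ (Fin (2 * n + 1))) ∞ M]
    [T2Space M] [SecondCountableTopology M]
    (c : ℝ) (hc : 0 < c)
    (C : SasakiCR.CRStructure (EuclideanSpace ℝ (Fin (2 * n + 1))) M)
    (hC : C.IsStrictlyPseudoconvex) (hS : C.IsSasakiType c) :
    (∃ ι : C.sasakianStructures c ≃ C.crPos c,
      (∀ S : C.sasakianStructures c, (ι S).1 = S.1.ξ) ∧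
      ∀ (S₀ : C.sasakianStructures c) (ξ : C.crPos c) (p : M)
        (v : TangentSpace 𝓘(ℝ, EuclideanSpace ℝ (Fin (2 * n + 1))) p),
        (ι.symm ξ).1.η p v = S₀.1.η p v / S₀.1.η p (ξ.1 p)) ∧
    ((CompactSpace M → IsOpen {X : C.cr | X.1 ∈ C.crPos c}) ∧
      Convex ℝ {X : C.cr | X.1 ∈ C.crPos c} ∧
      ∀ a : ℝ, 0 < a → ∀ X : C.cr, X.1 ∈ C.crPos c → (a • X).1 ∈ C.crPos c) ∧
    (∀ φ ∈ C.CRAut, SasakiCR.pushforward φ '' C.crPos c = C.crPos c) := by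
  have hE : 2 ≤ Module.finrank ℝ (EuclideanSpace ℝ (Fin (2 * n + 1))) := by
    rw [finrank_euclideanSpace_fin]
    omega
  obtain ⟨S, hS'⟩ := id hS
  exact ⟨⟨SasakiCR.CRStructure.reebEquiv hE hc hS, fun _ => rfl,
      SasakiCR.CRStructure.reebEquiv_symm_eta hE hc hS⟩,
    ⟨fun _ => SasakiCR.CRStructure.isOpen_crPos hE hc hS', SasakiCR.CRStructure.convex_crPos,
      fun _ ha _ hX => SasakiCR.CRStructure.smul_mem_crPos ha hX⟩,
    fun _ hφ => SasakiCR.CRStructure.pushforward_image_crPos hE hc hS' hφ⟩
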